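/- A \emph{constraint language} is a finite set $\Gamma$ of non-empty finitary Boolean relations $R\subseteq\{0,1\}^n$. A \emph{$\Gamma$-clause} is an expression $R(x_1,\dots,x_n)$ with $R\in\Gamma$ $n$-ary and $x_1,\dots,x_n$ (not necessarily distinct) variables; an assignment $\alpha$ satisfies it if $(\alpha(x_1),\dots,\alpha(x_n))\in R$. A \emph{$\Gamma$-formula} is a finite (possibly empty) conjunction of $\Gamma$-clauses. Two formulas are \emph{equivalent} ($\equiv$) if they are satisfied by the same assignments of all variables. A formula is \emph{irredundant} if removing any one of its clauses yields a formula that is not equivalent to it. A formula in the variables $x_1,\dots,x_n$ \emph{expresses} an $n$-ary relation $R$ if its set of solutions is $R$. A relation is \emph{affine} if it is expressed by a conjunction of clauses of the forms $x$, $\overline{x}$, $x_1\oplus\dots\oplus x_m$, $\neg(x_1\oplus\dots\oplus x_m)$. An $n$-ary relation $R$ is \emph{irreducible} if every formula $R_1(x^1_1,\dots,x^1_{k_1})\wedge\dots\wedge R_m(x^m_1,\dots,x^m_{k_m})$ with $m\ge 1$, with arbitrary Boolean relations $R_i$ of arities $k_i\ge 1$, and with variables among $x_1,\dots,x_n$,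 that expresses $R$ has some $k_i\ge n$. A constraint language is affine (irreducible) if all of its relations are. $\mathrm{MEE}(\Gamma)$ is the following decision problem: given a $\Gamma$-formula $\varphi$ and an integer $k$ (the indices of the variables and $k$ being written in binary), is there a $\Gamma$-formula $\psi$ with at most $k$ clauses and $\psi\equiv\varphi$? \textbf{Theorem.} Let $\Gamma$ be an irreducible and affine constraint language. Then: \begin{enumerate} \item $\mathrm{MEE}(\Gamma)\in\mathrm{P}$, i.e. the language of (codes of) its positive instances is decided by a Turing machine in polynomial time. \item If $\varphi$ is a satisfiable irredundant $\Gamma$-formula with $k$ clauses over a set of $n$ variables, then $k\le n$ and $\varphi$ has exactly $2^{n-k}$ solutions. \item Any two equivalent, satisfiable, irredundant $\Gamma$-formulas have the same number of clauses. \end{enumerate} -/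

import Mathlib

namespace BoolCSP

/-- A finitary Boolean relation: an arity `n` together with a set of Boolean `n`-tuples. -/
structure BoolRel where
  arity : ℕ
  tuples : Set (Fin arity → Bool)

/-- A constraint language is a finite set of non-empty finitary Boolean relations. -/
def IsConstraintLanguage (Γ : Set BoolRel) : Prop :=
  Γ.Finite ∧ ∀ R ∈ Γ, R.tuples.Nonempty

/-- A `Γ`-clause `R(x_1, …, x_n)` with `R ∈ Γ` and variables (repetitions allowed) from `V`. -/
structure Clause (Γ : Set BoolRel) (V : Type) where
  rel : Γ
  args : Fin rel.1.arity → V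

/-- The clause `R(x_1, …, x_n)` is satisfied by `α` if `(α x_1, …, α x_n) ∈ R`. -/
def Clause.Sat {Γ : Set BoolRel} {V : Type} (C : Clause Γ V) (α : V → Bool) : Prop :=
  (fun i => α (C.args i)) ∈ C.rel.1.tuples

/-- A `Γ`-formula is a finite conjunction of `Γ`-clauses; its number of clauses is the length
of the list. -/
abbrev Formula (Γ : Set BoolRel) (V : Type) : Type := List (Clause Γ V)

/-- `α` satisfies the conjunction `φ`. -/
def Sat {Γ : Set BoolRel} {V : Type} (φ : Formula Γ V) (α : V → Bool) : Prop :=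
  ∀ C ∈ φ, C.Sat α

/-- `φ` has at least one solution. -/
def Satisfiable {Γ : Set BoolRel} {V : Type} (φ : Formula Γ V) : Prop :=
  ∃ α, Sat φ α

/-- Equivalence: `φ` and `ψ` are satisfied by the same assignments of the variables. -/
def Equivalent {Γ Δ : Set BoolRel} {V : Type} (φ : Formula Γ V) (ψ : Formula Δ V) : Prop :=
  ∀ α : V → Bool, Sat φ α ↔ Sat ψ α

/-- No clause can be removed from `φ` without changing the set of solutions. -/
def Irredundant {Γ : Set BoolRel} {V : Type} (φ : Formula Γ V) : Prop :=
  ∀ i < φ.length, ¬ Equivalent (φ.eraseIdx i) φ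

/-- The relation `R` is expressed by a formula in the variables `x_1, …, x_n` (`n` the arity of
`R`) if its tuples are exactly the solutions of the formula. -/
def Expresses {Δ : Set BoolRel} {R : BoolRel} (φ : Formula Δ (Fin R.arity)) : Prop :=
  ∀ t : Fin R.arity → Bool, Sat φ t ↔ t ∈ R.tuples

/-- The relation `x_1 ⊕ … ⊕ x_n` (for `n = 1`: the literal `x`). -/
def xorRel (n : ℕ) : BoolRel where
  arity := n
  tuples := {t | Odd (Finset.univ.filter (fun i => t i = true)).card}

/-- The relation `¬(x_1 ⊕ … ⊕ x_n)` (for `n = 1`: the negated literal). -/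
def xnorRel (n : ℕ) : BoolRel where
  arity := n
  tuples := {t | ¬ Odd (Finset.univ.filter (fun i => t i = true)).card}

/-- All XOR relations `x_1 ⊕ … ⊕ x_n` and `¬(x_1 ⊕ … ⊕ x_n)`, including the two literals. -/
def xorRels : Set BoolRel := Set.range xorRel ∪ Set.range xnorRel

/-- A relation is affine if it is expressed by a conjunction of XOR clauses. -/
def BoolRel.Affine (R : BoolRel) : Prop :=
  ∃ φ : Formula xorRels (Fin R.arity), Expresses (R := R) φ

/-- An `n`-ary relation `R` is irreducible if every formula `R_1(…) ∧ … ∧ R_m(…)`, built from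
arbitrary Boolean relations `R_i` (`m ≥ 1`, all arities at least one) and equivalent to
`R(x_1, …, x_n)`, has a clause of arity at least `n`. In particular every unary relation is
irreducible. -/
def BoolRel.Irreducible (R : BoolRel) : Prop :=
  ∀ φ : Formula Set.univ (Fin R.arity), φ ≠ [] → (∀ C ∈ φ, 1 ≤ C.rel.1.arity) →
    Expresses (R := R) φ → ∃ C ∈ φ, R.arity ≤ C.rel.1.arity

/-- A constraint language is affine if all of its relations are. -/
def AffineLanguage (Γ : Set BoolRel) : Prop := ∀ R ∈ Γ, R.Affine

/-- A constraint language is irreducible if all of its relations are. -/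
def IrreducibleLanguage (Γ : Set BoolRel) : Prop := ∀ R ∈ Γ, R.Irreducible

/-- The input alphabet: a symbol for each relation of `Γ`, the two bits, a separator and a minus
sign. It is finite if `Γ` is. -/
inductive Letter (Γ : Set BoolRel) : Type
  | rel (R : Γ)
  | bit (b : Bool)
  | sep
  | minus

/-- Binary code of a natural number. -/
def codeNat (Γ : Set BoolRel) (n : ℕ) : List (Letter Γ) :=
  (Computability.encodeNat n).map Letter.bit

/-- Binary sign-magnitude code of an integer. -/
def codeInt (Γ : Set BoolRel) (k : ℤ) : List (Letter Γ) :=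
  if k < 0 then Letter.minus :: codeNat Γ k.natAbs else codeNat Γ k.natAbs

/-- The code of `R(x_1, …, x_n)`: the symbol `R`, then the binary indices of the variables, each
followed by a separator. -/
def codeClause {Γ : Set BoolRel} (C : Clause Γ ℕ) : List (Letter Γ) :=
  Letter.rel C.rel :: (List.ofFn C.args).flatMap (fun x => codeNat Γ x ++ [Letter.sep])

/-- The code of an instance `(φ, k)`: the codes of the clauses, a separator, the code of `k`. -/
def codeInstance {Γ : Set BoolRel} (φ : Formula Γ ℕ) (k : ℤ) : List (Letter Γ) :=
  φ.flatMap codeClause ++ Letter.sep :: codeInt Γ k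

/-- The problem MEE(Γ) as a language: the codes of all pairs `(φ, k)` of a `Γ`-formula `φ` and an
integer `k` such that some `Γ`-formula with at most `k` clauses is equivalent to `φ`. -/
def MEE (Γ : Set BoolRel) : Language (Letter Γ) :=
  {w | ∃ (φ : Formula Γ ℕ) (k : ℤ), w = codeInstance φ k ∧
    ∃ ψ : Formula Γ ℕ, (ψ.length : ℤ) ≤ k ∧ Equivalent ψ φ}

/-- The class P: the languages over a finite alphabet whose characteristic function is computed
by a (multi-stack) Turing machine within a number of steps polynomial in the length of the input
word. -/
def InP {A : Type} (L : Language A) : Prop :=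
  ∃ f : List A → Bool, (∀ w, f w = true ↔ w ∈ L) ∧
    Nonempty (Turing.TM2ComputableInPolyTime (id : List A → List A) Computability.encodeBool f)

end BoolCSP

/-! A non-empty irreducible affine relation is either full or the solution set of one equation x₁ +
… + xₙ = c over the field with two elements. Indeed, take a linear system for it. If some equation
involves some but not all variables, it can be added to every equation involving all of them. The
new system is equivalent, and each of its equations misses a variable, hence is a clause of arity n
- 1, against irreducibility. So every equation involves no variable or all of them, and since the
relation has a tuple, all those of the latter kind coincide (`BoolRel.exists_equation`).

A `Γ`-formula is therefore a linear system with one equation per clause. If it is satisfiable, its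
solutions form a coset of the kernel of the coefficient map (`sat_iff_sub_mem_ker`), so equivalent
formulas have equal kernels and equal ranks. If it is also irredundant, each clause is the only one
violated by some assignment; subtracting a solution gives a preimage of a unit vector, so the
coefficient map is onto (`range_finMap_eq_top`) and the number of clauses is the rank. Items 2 and 3
follow by rank-nullity and by invariance of the rank.

For item 1, the least length of a formula equivalent to a satisfiable one is its rank, because
deleting redundant clauses ends at an irredundant formula. Unsatisfiable formulas are all
equivalent, so their least length is a constant `minUnsat Γ`. It remains to parse the word, compute
the rank by Gaussian elimination, detect inconsistency, and compare with the bound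
(`outcome_le_iff`, `codeInstance_mem_iff`).

The matrix is stored transposed: one row per occurrence of a variable, one column per equation, and
the constants as an extra marked row at the end. The system is solvable iff the marked row lies in
the span of the others, that is, iff it never becomes a pivot (`elim_spec`). The algorithm is
written in a small language of stack programs with a time-bounded semantics `Exec`, which
`Exec.steps` transfers to Turing machines; the total time is cubic (`run_decider_accept`,
`run_decider_reject`). -/

open Turing Function

namespace BoolCSP

/-! ### Structured stack programs and their compilation to Turing machines. -/

/-- Structured programs over a family of stacks. `loop k body cont` pops the stack `k`, runs `body`
on the result, and repeats if `cont` of the result is true. -/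
inductive Cmd {K : Type} (A : K → Type) : Type
  | skip : Cmd A
  | push (k : K) (a : A k) : Cmd A
  | seq (c d : Cmd A) : Cmd A
  | loop (k : K) (body : Option (A k) → Cmd A) (cont : Option (A k) → Bool) : Cmd A

namespace Cmd

variable {K : Type} {A : K → Type}

/-- The control points of a program. -/
def Lab : Cmd A → Type
  | skip => Unit
  | push _ _ => Unit
  | seq c d => Lab c ⊕ Lab d
  | loop k body _ => Option (Σ o : Option (A k), Lab (body o))

/-- The control point at which a program starts. -/
def entry : (c : Cmd A) → Lab c
  | skip => ()
  | push _ _ => ()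
  | seq c _ => Sum.inl (entry c)
  | loop _ _ _ => none

theorem finite_lab [∀ k, Finite (A k)] : (c : Cmd A) → Finite (Lab c)
  | skip => inferInstanceAs (Finite Unit)
  | push _ _ => inferInstanceAs (Finite Unit)
  | seq c d => by
      have := finite_lab c
      have := finite_lab d
      exact inferInstanceAs (Finite (Lab c ⊕ Lab d))
  | loop k body _ => by
      have := fun o => finite_lab (body o)
      exact inferInstanceAs (Finite (Option (Σ o : Option (A k), Lab (body o))))

/-- The register of the machine: the symbol popped last. -/
abbrev Reg (A : K → Type) : Type := Option (Σ k, A k)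

open Classical in
/-- The symbol in the register, provided that it comes from stack `k`. -/
noncomputable def Reg.read (v : Reg A) (k : K) : Option (A k) :=
  v.bind fun x => if h : x.1 = k then some (h ▸ x.2) else none

theorem Reg.read_map (k : K) (o : Option (A k)) :
    Reg.read (o.map fun a => (⟨k, a⟩ : Σ k, A k)) k = o := by
  cases o <;> simp [Reg.read]

/-- The machine code of a program whose control points are embedded into `Λ` by `emb`, and which
continues at `exit`. -/
noncomputable def code {Λ : Type} :
    (c : Cmd A) → (Lab c → Λ) → Λ → Lab c → TM2.Stmt A Λ (Reg A)
  | skip, _, exit, _ => .goto fun _ => exit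
  | push k a, _, exit, _ => .push k (fun _ => a) (.goto fun _ => exit)
  | seq c d, emb, exit, l =>
      match l with
      | Sum.inl l => code c (fun l => emb (Sum.inl l)) (emb (Sum.inr (entry d))) l
      | Sum.inr l => code d (fun l => emb (Sum.inr l)) exit l
  | loop k body cont, emb, exit, l =>
      match l with
      | none => .pop k (fun _ o => o.map fun a => ⟨k, a⟩)
          (.goto fun v => emb (some ⟨Reg.read v k, entry (body (Reg.read v k))⟩))
      | some ⟨o, l⟩ =>
          code (body o) (fun l => emb (some ⟨o, l⟩)) (if cont o then emb none else exit) l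

variable [DecidableEq K]

/-- `Exec c s s' t`: the program `c` transforms the stacks `s` into `s'` in at most `t` steps. -/
inductive Exec : Cmd A → (∀ k, List (A k)) → (∀ k, List (A k)) → ℕ → Prop
  | skip (s) : Exec skip s s 1
  | push (k a s) : Exec (push k a) s (update s k (a :: s k)) 1
  | seq {c d s s' s'' t t'} : Exec c s s' t → Exec d s' s'' t' → Exec (seq c d) s s'' (t + t')
  | last {k body cont s s' t} : cont (s k).head? = false →
      Exec (body (s k).head?) (update s k (s k).tail) s' t → Exec (loop k body cont) s s' (t + 1)
  | next {k body cont s s' s'' t t'} : cont (s k).head? = true →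
      Exec (body (s k).head?) (update s k (s k).tail) s' t → Exec (loop k body cont) s' s'' t' →
      Exec (loop k body cont) s s'' (t + 1 + t')
  | weaken {c s s' t t'} : Exec c s s' t → t ≤ t' → Exec c s s' t'

/-- `n` steps of a machine lead from `a` to `b`. -/
def Steps {Λ : Type} (M : Λ → TM2.Stmt A Λ (Reg A)) (n : ℕ) (a b : TM2.Cfg A Λ (Reg A)) : Prop :=
  (flip bind (TM2.step M))^[n] (some a) = some b

theorem Steps.trans {Λ : Type} {M : Λ → TM2.Stmt A Λ (Reg A)} {m n : ℕ}
    {a b c : TM2.Cfg A Λ (Reg A)} (h : Steps M m a b) (h' : Steps M n b c) :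
    Steps M (m + n) a c := by
  unfold Steps at *
  rw [add_comm, iterate_add_apply, h, h']

theorem Steps.one {Λ : Type} {M : Λ → TM2.Stmt A Λ (Reg A)}
    {a b : TM2.Cfg A Λ (Reg A)} (h : TM2.step M a = some b) : Steps M 1 a b := h

/-- Induction on the execution. The embedding of the control points is arbitrary so that the
hypothesis applies to subprograms. The register is arbitrary because it is read only right after a
pop has overwritten it. -/
theorem Exec.steps {c : Cmd A} {s s' : ∀ k, List (A k)} {t : ℕ} (h : Exec c s s' t) :
    ∀ {Λ : Type} (M : Λ → TM2.Stmt A Λ (Reg A)) (emb : Lab c → Λ) (exit : Λ)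
      (_ : ∀ l, M (emb l) = code c emb exit l) (v : Reg A),
      ∃ n ≤ t, ∃ v', Steps M n ⟨some (emb (entry c)), v, s⟩ ⟨some exit, v', s'⟩ := by
  induction h with
  | skip s =>
      intro Λ M emb exit hM v
      refine ⟨1, le_rfl, v, Steps.one ?_⟩
      simp [TM2.step, hM, code]
  | push k a s =>
      intro Λ M emb exit hM v
      refine ⟨1, le_rfl, v, Steps.one ?_⟩
      simp [TM2.step, hM, code]
  | @seq c d s s' s'' t t' _ _ ih ih' =>
      intro Λ M emb exit hM v
      obtain ⟨n, hn, v', h⟩ := ih M (fun l => emb (Sum.inl l)) (emb (Sum.inr (entry d)))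
        (fun l => (hM (Sum.inl l)).trans (by rw [code])) v
      obtain ⟨n', hn', v'', h'⟩ := ih' M (fun l => emb (Sum.inr l)) exit
        (fun l => (hM (Sum.inr l)).trans (by rw [code])) v'
      exact ⟨n + n', by omega, v'', h.trans h'⟩
  | @last k body cont s s' t hc _ ih =>
      intro Λ M emb exit hM v
      obtain ⟨n, hn, v', h⟩ := ih M (fun l => emb (some ⟨_, l⟩)) exit
        (fun l => (hM (some ⟨_, l⟩)).trans (by rw [code]; simp [hc]))
        ((s k).head?.map fun a => ⟨k, a⟩)
      refine ⟨1 + n, by omega, v', Steps.trans (Steps.one ?_) h⟩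
      have := hM none
      rw [code] at this
      rw [entry, TM2.step, this]
      simp only [TM2.stepAux]
      rw [Reg.read_map]
  | @next k body cont s s' s'' t t' hc _ _ ih ih' =>
      intro Λ M emb exit hM v
      obtain ⟨n, hn, v', h⟩ := ih M (fun l => emb (some ⟨_, l⟩)) (emb none)
        (fun l => (hM (some ⟨_, l⟩)).trans (by rw [code]; simp [hc]))
        ((s k).head?.map fun a => ⟨k, a⟩)
      obtain ⟨n', hn', v'', h'⟩ := ih' M emb exit hM v'
      refine ⟨1 + n + n', by omega, v'', Steps.trans (Steps.trans (Steps.one ?_) h) h'⟩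
      have := hM none
      rw [code] at this
      rw [entry, TM2.step, this]
      simp only [TM2.stepAux]
      rw [Reg.read_map]
  | weaken _ hle ih =>
      intro Λ M emb exit hM v
      obtain ⟨n, hn, h⟩ := ih M emb exit hM v
      exact ⟨n, hn.trans hle, h⟩

/-- The code of the machine that runs a program and then halts. -/
noncomputable def machineCode (c : Cmd A) : Option (Lab c) → TM2.Stmt A (Option (Lab c)) (Reg A)
  | some l => code c some none l
  | none => .load (fun _ => none) .halt

/-- The machine that runs a program and then halts. -/
noncomputable def machine [Fintype K] [∀ k, Fintype (A k)] (k₀ k₁ : K) (c : Cmd A) : FinTM2 where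
  K := K
  k₀ := k₀
  k₁ := k₁
  Γ := A
  Λ := Option (Lab c)
  main := some (entry c)
  ΛFin := by
    have := finite_lab c
    exact Fintype.ofFinite _
  σ := Reg A
  initialState := none
  m := machineCode c

/-- A program that computes `f` in polynomial time, from the stack `k₀` to the stack `k₁`. -/
theorem inP_of_exec [Fintype K] [∀ k, Fintype (A k)] {k₀ k₁ : K} (hk : A k₁ = Bool)
    {L : Language (A k₀)} (f : List (A k₀) → Bool) (hf : ∀ w, f w = true ↔ w ∈ L)
    (c : Cmd A) (p : Polynomial ℕ)
    (h : ∀ w, Exec c (update (fun _ => []) k₀ w) (update (fun _ => []) k₁ [cast hk.symm (f w)])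
      (p.eval w.length)) : InP L := by
  refine ⟨f, hf, ⟨{
    tm := machine k₀ k₁ c
    inputAlphabet := Equiv.refl _
    outputAlphabet := Equiv.cast hk
    time := p + 1
    outputsFun := fun w => ?_ }⟩⟩
  have hs : ∃ n ≤ p.eval w.length + 1, Steps (machineCode c) n
      ⟨some (some (entry c)), none, update (fun _ => []) k₀ w⟩
      ⟨none, none, update (fun _ => []) k₁ [cast hk.symm (f w)]⟩ := by
    obtain ⟨n, hn, v, hv⟩ := (h w).steps (machineCode c) some none (fun _ => rfl) none
    -- The additional step resets the register, since a halting configuration must carry the initial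
    -- state.
    exact ⟨n + 1, by omega, hv.trans (Steps.one (by simp [TM2.step, machineCode]))⟩
  refine Classical.choice ?_
  obtain ⟨n, hn, hs⟩ := hs
  refine ⟨⟨⟨n, ?_⟩, by simpa using hn⟩⟩
  refine Eq.trans ?_ (Eq.trans (show _ = _ from hs) ?_)
  · refine congrArg (fun S => _^[n] (some (TM2.Cfg.mk (some (some (entry c))) none S)))
      (funext fun (k : K) => ?_)
    by_cases hk' : k = k₀
    · subst hk'
      refine (dif_pos rfl).trans ?_
      rw [update_self]
      exact List.map_id _
    · rw [update_of_ne hk']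
      exact dif_neg hk'
  · refine congrArg (fun S => some (TM2.Cfg.mk none none S)) (funext fun (k : K) => ?_)
    by_cases hk' : k = k₁
    · subst hk'
      rw [update_self]
      refine Eq.trans ?_ (dif_pos rfl).symm
      rfl
    · rw [update_of_ne hk']
      refine Eq.trans ?_ (dif_neg hk').symm
      rfl

end Cmd
-- The stacks of the decision procedure and basic run-time rules.
/-- The work alphabet. -/
inductive Tok : Type
  | bit (b : Bool)
  | mark (b : Bool)
  | eqn (b : Bool)
  deriving DecidableEq, Fintype

/-- The names of the stacks. -/
inductive Idx : Type
  | inp | out | q | f | g | o | k | x | y | h | e | m | n | p | r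
  deriving DecidableEq

instance : Fintype Idx where
  elems := {.inp, .out, .q, .f, .g, .o, .k, .x, .y, .h, .e, .m, .n, .p, .r}
  complete := by rintro ⟨⟩ <;> decide

/-- The alphabets of the stacks: `L` for the input, `Q` for the state of the parser. -/
@[reducible] def Alph (L Q : Type) : Idx → Type
  | .inp => L
  | .out => Bool
  | .q => Q
  | _ => Tok

/-- The contents of all stacks. -/
@[ext] structure St (L Q : Type) where
  inp : List L := []
  out : List Bool := []
  q : List Q := []
  f : List Tok := []
  g : List Tok := []
  o : List Tok := []
  k : List Tok := []
  x : List Tok := []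
  y : List Tok := []
  h : List Tok := []
  e : List Tok := []
  m : List Tok := []
  n : List Tok := []
  p : List Tok := []
  r : List Tok := []

variable {L Q : Type}

/-- The content of one stack. -/
@[simp] def St.get (s : St L Q) : ∀ i, List (Alph L Q i)
  | .inp => s.inp | .out => s.out | .q => s.q | .f => s.f | .g => s.g | .o => s.o | .k => s.k
  | .x => s.x | .y => s.y | .h => s.h | .e => s.e | .m => s.m | .n => s.n | .p => s.p | .r => s.r

/-- Replaces the content of one stack. -/
@[simp] def St.set (s : St L Q) : ∀ i, List (Alph L Q i) → St L Q
  | .inp, l => {s with inp := l}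
  | .out, l => {s with out := l}
  | .q, l => {s with q := l}
  | .f, l => {s with f := l}
  | .g, l => {s with g := l}
  | .o, l => {s with o := l}
  | .k, l => {s with k := l}
  | .x, l => {s with x := l}
  | .y, l => {s with y := l}
  | .h, l => {s with h := l}
  | .e, l => {s with e := l}
  | .m, l => {s with m := l}
  | .n, l => {s with n := l}
  | .p, l => {s with p := l}
  | .r, l => {s with r := l}

theorem St.update_get (s : St L Q) (i : Idx) (l : List (Alph L Q i)) :
    update s.get i l = (s.set i l).get := by
  funext j
  by_cases h : j = i
  · subst h
    rw [update_self]
    cases j <;> rfl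
  · rw [update_of_ne h]
    cases i <;> cases j <;> first | rfl | exact absurd rfl h

theorem St.set_get (s : St L Q) (i : Idx) : s.set i (s.get i) = s := by
  cases i <;> rfl

/-- Execution of a program on the concrete stacks. -/
def Run (c : Cmd (Alph L Q)) (s s' : St L Q) (t : ℕ) : Prop := c.Exec s.get s'.get t

namespace Run

variable {c d : Cmd (Alph L Q)} {s s' s'' : St L Q} {t t' : ℕ} {i : Idx}
  {body : Option (Alph L Q i) → Cmd (Alph L Q)} {cont : Option (Alph L Q i) → Bool}
  {a : Alph L Q i} {l : List (Alph L Q i)}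

theorem skip : Run (.skip : Cmd (Alph L Q)) s s 1 := Cmd.Exec.skip _

theorem push : Run (.push i a : Cmd (Alph L Q)) s (s.set i (a :: s.get i)) 1 := by
  unfold Run
  rw [← St.update_get]
  exact Cmd.Exec.push _ _ _

theorem seq (h : Run c s s' t) (h' : Run d s' s'' t') : Run (.seq c d) s s'' (t + t') :=
  Cmd.Exec.seq h h'

theorem weaken (h : Run c s s' t) (ht : t ≤ t') : Run c s s' t' := Cmd.Exec.weaken h ht

theorem of_eq (h : Run c s s' t) (hs : s' = s'') (ht : t ≤ t') : Run c s s'' t' :=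
  hs ▸ h.weaken ht

theorem nil_last (hs : s.get i = []) (hc : cont none = false) (h : Run (body none) s s' t) :
    Run (.loop i body cont) s s' (t + 1) := by
  refine Cmd.Exec.last (by rwa [hs]) ?_
  rwa [St.update_get, hs, List.tail_nil, List.head?_nil, ← hs, St.set_get]

theorem cons_last (hs : s.get i = a :: l) (hc : cont (some a) = false)
    (h : Run (body (some a)) (s.set i l) s' t) : Run (.loop i body cont) s s' (t + 1) := by
  refine Cmd.Exec.last (by rwa [hs]) ?_
  rwa [St.update_get, hs]

theorem cons_next (hs : s.get i = a :: l) (hc : cont (some a) = true)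
    (h : Run (body (some a)) (s.set i l) s' t) (h' : Run (.loop i body cont) s' s'' t') :
    Run (.loop i body cont) s s'' (t + 1 + t') := by
  refine Cmd.Exec.next (by rwa [hs]) ?_ h'
  rwa [St.update_get, hs]

end Run

/-- Pops a stack and branches on the result. -/
def popCase (i : Idx) (body : Option (Alph L Q i) → Cmd (Alph L Q)) : Cmd (Alph L Q) :=
  .loop i body fun _ => false

/-- Empties a stack, running `body` on each symbol. -/
def forEach (i : Idx) (body : Alph L Q i → Cmd (Alph L Q)) : Cmd (Alph L Q) :=
  .loop i (fun o => o.elim .skip body) Option.isSome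

/-- Empties a stack. -/
def clear (i : Idx) : Cmd (Alph L Q) := forEach i fun _ => .skip

namespace Run

variable {c d : Cmd (Alph L Q)} {s s' s'' : St L Q} {t t' : ℕ} {i : Idx}
  {body : Option (Alph L Q i) → Cmd (Alph L Q)} {each : Alph L Q i → Cmd (Alph L Q)}
  {a : Alph L Q i} {l : List (Alph L Q i)}

theorem popCase_nil (hs : s.get i = []) (h : Run (body none) s s' t) :
    Run (popCase i body) s s' (t + 1) := nil_last hs rfl h

theorem popCase_cons (hs : s.get i = a :: l) (h : Run (body (some a)) (s.set i l) s' t) :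
    Run (popCase i body) s s' (t + 1) := cons_last hs rfl h

theorem forEach_nil (hs : s.get i = []) : Run (forEach i each) s s 2 :=
  nil_last hs rfl skip

theorem forEach_cons (hs : s.get i = a :: l) (h : Run (each a) (s.set i l) s' t)
    (h' : Run (forEach i each) s' s'' t') : Run (forEach i each) s s'' (t + 1 + t') :=
  cons_next hs rfl h h'

theorem clear_all (i : Idx) (s : St L Q) :
    Run (clear i) s (s.set i []) (2 * (s.get i).length + 2) := by
  induction hl : s.get i generalizing s with
  | nil => rw [← hl, St.set_get]; exact weaken (forEach_nil hl) (by omega)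
  | cons a l ih =>
    have h1 : (s.set i l).get i = l := by cases i <;> rfl
    have h2 : (s.set i l).set i [] = s.set i [] := by cases i <;> rfl
    have := ih (s.set i l) h1
    rw [h2] at this
    exact (forEach_cons hl skip this).weaken (by simp only [List.length_cons]; omega)

end Run

/-! ### Moving stacks -/

/-- Moves the stack `g` onto the stack `f`. -/
def gToF : Cmd (Alph L Q) := forEach .g fun a => .push .f a

theorem run_gToF (l : List Tok) (s : St L Q) (hs : s.g = l) :
    Run gToF s {s with g := [], f := l.reverse ++ s.f} (2 * l.length + 2) := by
  induction l generalizing s with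
  | nil => exact Run.of_eq (Run.forEach_nil hs) (by ext1 <;> simp [hs]) (by simp)
  | cons a l ih =>
    exact Run.of_eq (Run.forEach_cons hs Run.push (ih {s with g := l, f := a :: s.f} rfl))
      (by simp) (by simp only [List.length_cons]; omega)

/-- Moves the stack `h` onto the stack `x`. -/
def hToX : Cmd (Alph L Q) := forEach .h fun a => .push .x a

theorem run_hToX (l : List Tok) (s : St L Q) (hs : s.h = l) :
    Run hToX s {s with h := [], x := l.reverse ++ s.x} (2 * l.length + 2) := by
  induction l generalizing s with
  | nil => exact Run.of_eq (Run.forEach_nil hs) (by ext1 <;> simp [hs]) (by simp)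
  | cons a l ih =>
    exact Run.of_eq (Run.forEach_cons hs Run.push (ih {s with h := l, x := a :: s.x} rfl))
      (by simp) (by simp only [List.length_cons]; omega)

/-- Moves the stack `h` onto the stack `p`. -/
def hToP : Cmd (Alph L Q) := forEach .h fun a => .push .p a

theorem run_hToP (l : List Tok) (s : St L Q) (hs : s.h = l) :
    Run hToP s {s with h := [], p := l.reverse ++ s.p} (2 * l.length + 2) := by
  induction l generalizing s with
  | nil => exact Run.of_eq (Run.forEach_nil hs) (by ext1 <;> simp [hs]) (by simp)
  | cons a l ih =>
    exact Run.of_eq (Run.forEach_cons hs Run.push (ih {s with h := l, p := a :: s.p} rfl))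
      (by simp) (by simp only [List.length_cons]; omega)

/-- Moves the stack `h` onto the stack `k`. -/
def hToK : Cmd (Alph L Q) := forEach .h fun a => .push .k a

theorem run_hToK (l : List Tok) (s : St L Q) (hs : s.h = l) :
    Run hToK s {s with h := [], k := l.reverse ++ s.k} (2 * l.length + 2) := by
  induction l generalizing s with
  | nil => exact Run.of_eq (Run.forEach_nil hs) (by ext1 <;> simp [hs]) (by simp)
  | cons a l ih =>
    exact Run.of_eq (Run.forEach_cons hs Run.push (ih {s with h := l, k := a :: s.k} rfl))
      (by simp) (by simp only [List.length_cons]; omega)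

/-- Moves the stack `n` onto the stack `m`. -/
def nToM : Cmd (Alph L Q) := forEach .n fun a => .push .m a

theorem run_nToM (l : List Tok) (s : St L Q) (hs : s.n = l) :
    Run nToM s {s with n := [], m := l.reverse ++ s.m} (2 * l.length + 2) := by
  induction l generalizing s with
  | nil => exact Run.of_eq (Run.forEach_nil hs) (by ext1 <;> simp [hs]) (by simp)
  | cons a l ih =>
    exact Run.of_eq (Run.forEach_cons hs Run.push (ih {s with n := l, m := a :: s.m} rfl))
      (by simp) (by simp only [List.length_cons]; omega)

variable {L Q : Type}

/-! ### Codes of linear systems and of matrices. -/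

/-- The code of a variable name. -/
def codeName (y : List Bool) : List Tok := y.map .bit ++ [.mark false]

/-- The code of an equation: the constant and the names of the variables. -/
def codeEqn (e : Bool × List (List Bool)) : List Tok := .eqn e.1 :: e.2.flatMap codeName

/-- The code of a system of equations. -/
def codeSys (E : List (Bool × List (List Bool))) : List Tok := E.flatMap codeEqn

/-- The parity of the number of occurrences of `x` in a list, starting from `b`. -/
def parityFrom (x : List Bool) (b : Bool) (ys : List (List Bool)) : Bool :=
  ys.foldl (fun b y => xor b (decide (y = x))) b

/-- The coefficients of the variable `x` in the equations of a system. -/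
def coeffs (x : List Bool) (E : List (Bool × List (List Bool))) : List Bool :=
  E.map fun e => parityFrom x false e.2

/-- The code of a marked row of bits. -/
def codeRow (r : List Bool × Bool) : List Tok := r.1.map .bit ++ [.mark r.2]

/-- The code of a list of marked rows. -/
def codeRows (rows : List (List Bool × Bool)) : List Tok := rows.flatMap codeRow

/-! ### Comparing names -/

/-- Compares `y` with the beginning of `x`, which is moved to `h`; differences are logged in `e`. -/
def cmpLoop : Cmd (Alph L Q) := forEach .y fun b => popCase .x fun
  | some b' => .seq (.push .h b') (if b = b' then .skip else .push .e b)
  | none => .push .e b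

/-- The stack `e` serves as a flag: only its emptiness carries information. Its content is left
existential, with a length bound that pays for clearing it later. -/
theorem run_cmpLoop (Y X : List Tok) (s : St L Q) (hx : s.x = X) (hy : s.y = Y) :
    ∃ e', Run cmpLoop s {s with
        y := [], x := X.drop Y.length,
        h := (X.take Y.length).reverse ++ s.h, e := e'} (4 * Y.length + 2) ∧
      (e' = [] ↔ s.e = [] ∧ Y <+: X) ∧ e'.length ≤ s.e.length + Y.length := by
  induction Y generalizing X s with
  | nil =>
    exact ⟨s.e, Run.of_eq (Run.forEach_nil hy) (by ext1 <;> simp [hx, hy]) (by simp),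
      by simp, by simp⟩
  | cons b Y ih =>
    cases X with
    | nil =>
      obtain ⟨e', h1, h2, h3⟩ := ih [] {s with y := Y, e := b :: s.e} hx rfl
      refine ⟨e', Run.of_eq (Run.forEach_cons hy (Run.popCase_nil hx Run.push) h1) (by simp) ?_,
        ?_, ?_⟩
      · simp only [List.length_cons]; omega
      · simp [h2]
      · simp only [List.length_cons] at *; omega
    | cons b' X =>
      by_cases hb : b = b'
      · obtain ⟨e', h1, h2, h3⟩ := ih X {s with y := Y, x := X, h := b' :: s.h} rfl rfl
        refine ⟨e', Run.of_eq (Run.forEach_cons hy (Run.popCase_cons hx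
          (Run.seq (t' := 1) Run.push ?_)) h1) (by simp) ?_, ?_, ?_⟩
        · rw [if_pos hb]; exact Run.skip
        · simp only [List.length_cons]; omega
        · simp [h2, hb, List.cons_prefix_cons]
        · simp only [List.length_cons] at *; omega
      · obtain ⟨e', h1, h2, h3⟩ := ih X {s with y := Y, x := X, h := b' :: s.h, e := b :: s.e}
          rfl rfl
        refine ⟨e', Run.of_eq (Run.forEach_cons hy (Run.popCase_cons hx
          (Run.seq (t' := 1) Run.push ?_)) h1) (by simp) ?_, ?_, ?_⟩
        · rw [if_neg hb]; exact Run.push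
        · simp only [List.length_cons]; omega
        · simp [h2, hb, List.cons_prefix_cons]
        · simp only [List.length_cons] at *; omega

/-- Negates the bit on top of `m`. -/
def toggle : Cmd (Alph L Q) := popCase .m fun
  | some (.bit b) => .push .m (.bit !b)
  | _ => .skip

/-- Negates the bit on top of `m` if `x` and `y` are equal. Empties `y`. -/
def toggleIfEq : Cmd (Alph L Q) :=
  .seq cmpLoop <| .seq
    (popCase .x fun
      | some b => .seq (.push .h b) (.push .e b)
      | none => .skip) <|
    .seq hToX <| popCase .e fun
      | some _ => clear .e
      | none => toggle

theorem run_toggleIfEq (s : St L Q) (b : Bool) (l : List Tok) (he : s.e = []) (hh : s.h = [])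
    (hm : s.m = .bit b :: l) :
    Run toggleIfEq s {s with y := [], m := .bit (xor b (decide (s.y = s.x))) :: l}
      (8 * s.y.length + 20) := by
  obtain ⟨e₁, h1, h2, h3⟩ := run_cmpLoop s.y s.x s rfl rfl
  -- One more pop from `x` separates equality from a proper prefix: a leftover symbol is logged as a
  -- difference.
  obtain ⟨e₂, he2, hel, h4⟩ : ∃ e₂, (e₂ = [] ↔ s.y = s.x) ∧ e₂.length ≤ s.y.length + 1 ∧
      Run (popCase .x fun
        | some b => .seq (.push .h b) (.push .e b)
        | none => .skip) {s with
          y := [], x := s.x.drop s.y.length,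
          h := (s.x.take s.y.length).reverse ++ s.h, e := e₁}
        {s with
          y := [], x := s.x.drop (s.y.length + 1),
          h := (s.x.take (s.y.length + 1)).reverse, e := e₂} 3 := by
    cases hd : s.x.drop s.y.length with
    | nil =>
      have hlen : s.x.length ≤ s.y.length := List.drop_eq_nil_iff.1 hd
      refine ⟨e₁, ?_, by simp [he] at h3; omega, ?_⟩
      · rw [h2]
        simp only [he, true_and]
        exact ⟨fun h => h.eq_of_length_le hlen, fun h => h ▸ List.prefix_rfl⟩
      · refine Run.of_eq (Run.popCase_nil rfl Run.skip) ?_ (by simp)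
        rw [List.drop_eq_nil_of_le (by omega), List.take_of_length_le (by omega),
          List.take_of_length_le (by omega)]
        simp [hh]
    | cons a X =>
      refine ⟨a :: e₁, ?_, by simp [he] at h3; simp; omega, ?_⟩
      · simp only [reduceCtorEq, false_iff]
        intro h
        rw [h] at hd
        simp at hd
      · refine Run.of_eq (Run.popCase_cons rfl (Run.seq Run.push Run.push)) ?_ (by simp)
        rw [List.take_add, List.drop_add_one_eq_tail_drop, hd]
        simp [hh]
  have h5 := run_hToX _ {s with
    y := [], x := s.x.drop (s.y.length + 1),
    h := (s.x.take (s.y.length + 1)).reverse, e := e₂} rfl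
  have ht : (s.x.take (s.y.length + 1)).length ≤ s.y.length + 1 := List.length_take_le _ _
  simp only [List.reverse_reverse, List.take_append_drop, List.length_reverse] at h5
  by_cases hxy : s.y = s.x
  · have h6 : e₂ = [] := he2.2 hxy
    subst h6
    refine Run.of_eq (.seq h1 (.seq h4 (.seq h5 (.popCase_nil rfl (.popCase_cons hm .push))))) ?_ ?_
    · simp [hh, he, hxy]
    · omega
  · cases e₂ with
    | nil => exact absurd (he2.1 rfl) hxy
    | cons a e₂ =>
      refine Run.of_eq (.seq h1 (.seq h4 (.seq h5 (.popCase_cons rfl (.clear_all _ _))))) ?_ ?_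
      · simp [hh, he, hxy, hm]
      · simp at hel ⊢; omega

/-! ### One row of the matrix -/

/-- Goes through the system in `f` and pushes the coefficients of the variable `x` to `m`. -/
def scan : Cmd (Alph L Q) := forEach .f fun a => .seq (.push .g a) <| match a with
  | .eqn _ => .push .m (.bit false)
  | .bit b => .push .y (.bit b)
  | .mark _ => toggleIfEq

/-- The remaining run is a hypothesis, so that this lemma and the next ones chain along the
concatenated pieces of the code in `f`, each adding its own cost. -/
theorem scan_bits (l : List Bool) {rest : List Tok} {s s' : St L Q} {t : ℕ}
    (hf : s.f = l.map .bit ++ rest)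
    (h : Run scan {s with
      f := rest, g := (l.map .bit).reverse ++ s.g,
      y := (l.map .bit).reverse ++ s.y} s' t) :
    Run scan s s' (3 * l.length + t) := by
  induction l generalizing s with
  | nil =>
    simp only [List.map_nil, List.nil_append] at hf
    subst hf
    simpa using h
  | cons a l ih =>
    refine Run.weaken (.forEach_cons hf (.seq .push .push) (ih (by rfl) ?_)) ?_
    · simpa using h
    · simp only [List.length_cons]; omega

/-- Reading a name reverses it in `y`; the name in `x` is reversed as well, so comparing the two
stacks compares the names. -/
theorem scan_name (x y : List Bool) {rest l : List Tok} {b : Bool} {s s' : St L Q} {t : ℕ}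
    (hf : s.f = codeName y ++ rest) (hx : s.x = (x.map .bit).reverse) (hy : s.y = [])
    (he : s.e = []) (hh : s.h = []) (hm : s.m = .bit b :: l)
    (h : Run scan {s with
      f := rest, g := (codeName y).reverse ++ s.g,
      m := .bit (xor b (decide (y = x))) :: l} s' t) :
    Run scan s s' (30 * (codeName y).length + t) := by
  refine Run.weaken (scan_bits (rest := .mark false :: rest) y (by simpa [codeName] using hf)
    (.forEach_cons rfl (.seq .push (run_toggleIfEq _ b l he hh hm)) (t' := t) ?_)) ?_
  · have : (List.map Tok.bit y = List.map Tok.bit x) ↔ y = x :=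
      List.map_inj_right (by intro a b h; injection h)
    change Run scan _ _ _
    simpa [codeName, hx, hy, this] using h
  · simp [codeName, hy]; omega

theorem scan_names (x : List Bool) (ys : List (List Bool)) {rest l : List Tok} {b : Bool}
    {s s' : St L Q} {t : ℕ}
    (hf : s.f = ys.flatMap codeName ++ rest) (hx : s.x = (x.map .bit).reverse) (hy : s.y = [])
    (he : s.e = []) (hh : s.h = []) (hm : s.m = .bit b :: l)
    (h : Run scan {s with
      f := rest, g := (ys.flatMap codeName).reverse ++ s.g,
      m := .bit (parityFrom x b ys) :: l} s' t) :
    Run scan s s' (30 * (ys.flatMap codeName).length + t) := by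
  induction ys generalizing s b with
  | nil =>
    simp only [List.flatMap_nil, List.nil_append] at hf
    subst hf
    simpa [parityFrom, ← hm] using h
  | cons y ys ih =>
    refine Run.weaken (scan_name x y (by simpa using hf) hx hy he hh hm
      (ih (by rfl) hx hy he hh (by rfl) ?_)) ?_
    · simpa [parityFrom] using h
    · simp only [List.flatMap_cons, List.length_append]; omega

theorem scan_sys (x : List Bool) (E : List (Bool × List (List Bool))) {rest : List Tok}
    {s s' : St L Q} {t : ℕ}
    (hf : s.f = codeSys E ++ rest) (hx : s.x = (x.map .bit).reverse) (hy : s.y = [])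
    (he : s.e = []) (hh : s.h = [])
    (h : Run scan {s with
      f := rest, g := (codeSys E).reverse ++ s.g,
      m := ((coeffs x E).map .bit).reverse ++ s.m} s' t) :
    Run scan s s' (30 * (codeSys E).length + t) := by
  induction E generalizing s with
  | nil =>
    simp only [codeSys, List.flatMap_nil, List.nil_append] at hf
    subst hf
    simpa [codeSys, coeffs] using h
  | cons e E ih =>
    refine Run.weaken (.forEach_cons (a := .eqn e.1)
        (l := e.2.flatMap codeName ++ (codeSys E ++ rest))
      (by simpa [codeSys, codeEqn] using hf) (.seq .push .push)
      (scan_names x e.2 rfl hx hy he hh rfl (ih (by rfl) hx hy he hh ?_))) ?_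
    · simpa [codeSys, codeEqn, coeffs] using h
    · simp [codeSys, codeEqn]; omega

theorem run_scan (x : List Bool) (E : List (Bool × List (List Bool))) (s : St L Q)
    (hf : s.f = codeSys E) (hx : s.x = (x.map .bit).reverse) (hy : s.y = [])
    (he : s.e = []) (hh : s.h = []) :
    Run scan s {s with
      f := [], g := (codeSys E).reverse ++ s.g,
      m := ((coeffs x E).map .bit).reverse ++ s.m} (30 * (codeSys E).length + 2) :=
  scan_sys x E (rest := []) (by simpa using hf) hx hy he hh (.forEach_nil rfl)

variable {L Q : Type}

/-! ### The matrix -/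

/-- Moves the code of the bound from `g` to `k`. -/
def loadK : Cmd (Alph L Q) := .loop .g
  (fun | some (.bit b) => .push .k (.bit b) | _ => .skip)
  (fun | some (.bit _) => true | _ => false)

theorem run_loadK (l : List Bool) {rest : List Tok} {b : Bool} (s : St L Q)
    (hg : s.g = l.map .bit ++ .mark b :: rest) :
    Run loadK s {s with g := rest, k := (l.map .bit).reverse ++ s.k} (2 * l.length + 2) := by
  induction l generalizing s with
  | nil => exact Run.of_eq (.cons_last hg rfl .skip) (by simp) (by simp)
  | cons a l ih =>
    refine Run.of_eq (.cons_next hg rfl .push (ih _ (by rfl))) (by simp) ?_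
    simp only [List.length_cons]; omega

/-- Moves `g` to both `f` and `o`. -/
def gToFO : Cmd (Alph L Q) := forEach .g fun a => .seq (.push .f a) (.push .o a)

theorem run_gToFO (l : List Tok) (s : St L Q) (hg : s.g = l) :
    Run gToFO s {s with g := [], f := l.reverse ++ s.f, o := l.reverse ++ s.o}
      (3 * l.length + 2) := by
  induction l generalizing s with
  | nil => exact Run.of_eq (.forEach_nil hg) (by ext1 <;> simp [hg]) (by simp)
  | cons a l ih =>
    refine Run.of_eq (.forEach_cons hg (.seq .push .push) (ih _ (by rfl))) (by simp) ?_
    simp only [List.length_cons]; omega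

/-- The constant of an equation, as a bit. -/
def constBit : Tok → Option Tok
  | .eqn c => some (.bit c)
  | _ => none

/-- Pushes the constants of the equations in `f` to `m`; moves `f` to `g`. -/
def constScan : Cmd (Alph L Q) := forEach .f fun a => .seq (.push .g a) <| match constBit a with
  | some b => .push .m b
  | none => .skip

theorem run_constScan (l : List Tok) (s : St L Q) (hf : s.f = l) :
    Run constScan s {s with
      f := [], g := l.reverse ++ s.g,
      m := (l.filterMap constBit).reverse ++ s.m} (3 * l.length + 2) := by
  induction l generalizing s with
  | nil => exact Run.of_eq (.forEach_nil hf) (by ext1 <;> simp [hf]) (by simp)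
  | cons a l ih =>
    cases hb : constBit a with
    | none =>
      refine Run.of_eq (.forEach_cons hf (.seq (t' := 1) .push (by rw [hb]; exact .skip))
        (ih _ (by rfl))) (by simp [hb]) ?_
      simp only [List.length_cons]; omega
    | some b =>
      refine Run.of_eq (.forEach_cons hf (.seq (t' := 1) .push (by rw [hb]; exact .push))
        (ih _ (by rfl))) (by simp [hb]) ?_
      simp only [List.length_cons]; omega

theorem filterMap_constBit (E : List (Bool × List (List Bool))) :
    (codeSys E).filterMap constBit = (E.map Prod.fst).map .bit := by
  have hname (y : List Bool) : (codeName y).filterMap constBit = [] := by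
    simp [codeName, constBit, List.filterMap_eq_nil_iff]
  have hnames (ys : List (List Bool)) : (ys.flatMap codeName).filterMap constBit = [] := by
    induction ys with
    | nil => rfl
    | cons y ys ih => simp [hname, ih]
  induction E with
  | nil => rfl
  | cons e E ih =>
    rw [codeSys] at ih
    simp [codeSys, codeEqn, hnames, ih, constBit]

/-- The row of a variable. -/
def rowOf (E : List (Bool × List (List Bool))) (x : List Bool) : List Bool × Bool :=
  ((coeffs x E).reverse, false)

/-- Pushes to `m` a row for each name in `o`. -/
def nameRows : Cmd (Alph L Q) := forEach .o fun
  | .eqn _ => .skip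
  | .bit b => .push .x (.bit b)
  | .mark _ => .seq (.push .m (.mark false)) <| .seq scan <| .seq gToF (clear .x)

section

variable {E : List (Bool × List (List Bool))} {rest : List Tok} {s s' : St L Q} {t : ℕ}

theorem nameRows_bits (l : List Bool) (ho : s.o = l.map .bit ++ rest)
    (h : Run nameRows {s with o := rest, x := (l.map .bit).reverse ++ s.x} s' t) :
    Run nameRows s s' (2 * l.length + t) := by
  induction l generalizing s with
  | nil =>
    simp only [List.map_nil, List.nil_append] at ho
    subst ho
    simpa using h
  | cons a l ih =>
    refine Run.weaken (.forEach_cons ho .push (ih (by rfl) ?_)) ?_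
    · simpa using h
    · simp only [List.length_cons]; omega

/-- The mark is pushed before the coefficients, which are then stacked in the order of the
equations. Read from the top, the row is reversed and ends in its mark, whence the `reverse` in
`rowOf`. -/
theorem nameRows_name (x : List Bool) (hf : s.f = codeSys E) (hg : s.g = []) (hx : s.x = [])
    (hy : s.y = []) (he : s.e = []) (hh : s.h = []) (ho : s.o = codeName x ++ rest)
    (h : Run nameRows {s with o := rest, m := codeRow (rowOf E x) ++ s.m} s' t) :
    Run nameRows s s' ((32 * (codeSys E).length + 12) * (codeName x).length + t) := by
  refine Run.weaken (nameRows_bits (rest := .mark false :: rest) x (by simpa [codeName] using ho)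
    (.forEach_cons rfl (.seq .push (.seq (run_scan x E _ hf (by simp [hx]) hy he hh)
      (.seq (run_gToF (codeSys E).reverse _ (by simp [hg])) (.clear_all _ _)))) (t' := t) ?_)) ?_
  · change Run nameRows _ _ _
    convert h using 1
    ext1 <;> simp [codeRow, rowOf, hf, hg, hx]
  · simp [codeName, hx]
    nlinarith [Nat.zero_le ((codeSys E).length * x.length)]

theorem nameRows_names (l : List (List Bool)) (hf : s.f = codeSys E) (hg : s.g = [])
    (hx : s.x = []) (hy : s.y = []) (he : s.e = []) (hh : s.h = [])
    (ho : s.o = l.flatMap codeName ++ rest)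
    (h : Run nameRows {s with o := rest, m := codeRows (l.map (rowOf E)).reverse ++ s.m} s' t) :
    Run nameRows s s' ((32 * (codeSys E).length + 12) * (l.flatMap codeName).length + t) := by
  induction l generalizing s with
  | nil =>
    simp only [List.flatMap_nil, List.nil_append] at ho
    subst ho
    simpa [codeRows] using h
  | cons x l ih =>
    refine Run.weaken (nameRows_name x hf hg hx hy he hh (by simpa using ho)
      (ih hf hg hx hy he hh (by rfl) ?_)) ?_
    · simpa [codeRows] using h
    · simp only [List.flatMap_cons, List.length_append, mul_add]; omega

theorem nameRows_sys (E' : List (Bool × List (List Bool))) (hf : s.f = codeSys E) (hg : s.g = [])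
    (hx : s.x = []) (hy : s.y = []) (he : s.e = []) (hh : s.h = [])
    (ho : s.o = codeSys E' ++ rest)
    (h : Run nameRows {s with
      o := rest, m := codeRows ((E'.flatMap Prod.snd).map (rowOf E)).reverse ++ s.m} s' t) :
    Run nameRows s s' ((32 * (codeSys E).length + 12) * (codeSys E').length + t) := by
  induction E' generalizing s with
  | nil =>
    simp only [codeSys, List.flatMap_nil, List.nil_append] at ho
    subst ho
    simpa [codeRows, codeSys] using h
  | cons e E' ih =>
    refine Run.weaken (.forEach_cons (a := .eqn e.1)
        (l := e.2.flatMap codeName ++ (codeSys E' ++ rest))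
      (by simpa [codeSys, codeEqn] using ho) .skip
      (nameRows_names e.2 hf hg hx hy he hh rfl (ih hf hg hx hy he hh (by rfl) ?_))) ?_
    · simpa [codeRows] using h
    · simp only [codeSys, List.flatMap_cons, List.length_append, codeEqn, List.length_cons, mul_add,
        mul_one]
      omega

end

/-- The rows of the variables of a system, and the marked row of the constants. -/
def matrixRows (E : List (Bool × List (List Bool))) : List (List Bool × Bool) :=
  ((E.flatMap Prod.snd).map (rowOf E)).reverse ++ [((E.map Prod.fst).reverse, true)]

/-- Builds the matrix of the system in `g`. -/
def buildMatrix : Cmd (Alph L Q) :=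
  .seq loadK <| .seq gToFO <| .seq (.push .m (.mark true)) <| .seq constScan <| .seq gToF nameRows

/-- The output of the parser lies in `g` in reverse, with the bound on top. The row of constants is
pushed to `m` first and so comes last in the matrix; the elimination relies on this. -/
theorem run_buildMatrix (E : List (Bool × List (List Bool))) (κ : List Bool) :
    Run buildMatrix ({g := (codeSys E ++ Tok.mark true :: κ.map Tok.bit).reverse} : St L Q)
      {f := codeSys E, k := κ.map .bit, m := codeRows (matrixRows E)}
      (2 * κ.length + 32 * ((codeSys E).length + 1) ^ 2) := by
  refine Run.of_eq (.seq (run_loadK κ.reverse (b := true) (rest := (codeSys E).reverse) _ (by simp))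
    (.seq (run_gToFO (codeSys E).reverse _ rfl) (.seq .push
    (.seq (run_constScan (codeSys E) _ (by simp)) (.seq (run_gToF (codeSys E).reverse _ (by simp))
    (nameRows_sys (E := E) (rest := []) E (by simp) rfl rfl rfl rfl rfl (by simp)
        (t := 2) ?_)))))) rfl ?_
  · exact Run.of_eq (.forEach_nil rfl)
      (by simp [matrixRows, codeRows, codeRow, filterMap_constBit]) le_rfl
  · simp only [List.length_reverse]
    nlinarith
variable {L Q : Type}

/-! ### Elimination -/

/-- Eliminates the first column of a matrix with marked rows. The first component is the pivot row,
without its first entry; `p` is the pivot row if it has been found already. -/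
def elimStep : Option (List Bool × Bool) → List (List Bool × Bool) →
    Option (List Bool × Bool) × List (List Bool × Bool)
  | p, [] => (p, [])
  | p, r :: rows =>
    match r.1.headD false, p with
    | false, p => ((elimStep p rows).1, (r.1.tail, r.2) :: (elimStep p rows).2)
    | true, none => elimStep (some (r.1.tail, r.2)) rows
    | true, some q => ((elimStep (some q) rows).1,
        (List.zipWith xor r.1.tail q.1, r.2) :: (elimStep (some q) rows).2)

/-- Eliminates `n` columns, and lists the marks of the pivot rows on top of `acc`. -/
def elim : ℕ → List (List Bool × Bool) → List Bool → List Bool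
  | 0, _, acc => acc
  | n + 1, rows, acc =>
    elim n (elimStep none rows).2 ((elimStep none rows).1.elim acc fun q => q.2 :: acc)

/-- Every row has length `n`. -/
def IsWidth (n : ℕ) (rows : List (List Bool × Bool)) : Prop := ∀ r ∈ rows, r.1.length = n

theorem length_codeRows {n : ℕ} {rows : List (List Bool × Bool)} (h : IsWidth n rows) :
    (codeRows rows).length = rows.length * (n + 1) := by
  induction rows with
  | nil => simp [codeRows]
  | cons r rows ih =>
    have h1 := ih fun r hr => h r (List.mem_cons_of_mem _ hr)
    have h2 := h r (List.mem_cons_self ..)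
    simp only [codeRows, List.flatMap_cons, List.length_append, List.length_cons] at h1 ⊢
    rw [h1]
    simp [codeRow, h2]
    ring

theorem elimStep_width {n : ℕ} (rows : List (List Bool × Bool)) (p : Option (List Bool × Bool))
    (h : IsWidth (n + 1) rows) (hp : ∀ q ∈ p, q.1.length = n) :
    IsWidth n (elimStep p rows).2 ∧ (elimStep p rows).2.length ≤ rows.length ∧
      ∀ q ∈ (elimStep p rows).1, q.1.length = n := by
  induction rows generalizing p with
  | nil => exact ⟨by simp [elimStep, IsWidth], by simp [elimStep], by simpa [elimStep] using hp⟩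
  | cons r rows ih =>
    obtain ⟨⟨⟩ | ⟨b, l⟩, mk⟩ := r
    · simpa using h _ (List.mem_cons_self ..)
    have hl : l.length = n := by simpa using h _ (List.mem_cons_self ..)
    have hr : IsWidth (n + 1) rows := fun r hr => h r (List.mem_cons_of_mem _ hr)
    cases b with
    | false =>
      obtain ⟨h1, h2, h3⟩ := ih p hr hp
      simp only [elimStep, List.headD_cons, List.tail_cons]
      refine ⟨fun r hr => ?_, by simpa using h2, h3⟩
      rcases List.mem_cons.1 hr with rfl | hr
      exacts [hl, h1 r hr]
    | true =>
      cases p with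
      | none =>
        obtain ⟨h1, h2, h3⟩ := ih (some (l, mk)) hr (by simpa using hl)
        exact ⟨h1, h2.trans (by simp), h3⟩
      | some q =>
        obtain ⟨h1, h2, h3⟩ := ih (some q) hr hp
        simp only [elimStep, List.headD_cons, List.tail_cons]
        refine ⟨fun r hr => ?_, by simpa using h2, h3⟩
        rcases List.mem_cons.1 hr with rfl | hr
        exacts [by simp [hl, hp q rfl], h1 r hr]

/-- Moves a row from `m` to `n`. -/
def moveRow : Cmd (Alph L Q) := .loop .m
  (fun | some a => .push .n a | none => .skip) (fun | some (.bit _) => true | _ => false)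

theorem run_moveRow (l : List Bool) {b : Bool} {rest : List Tok} (s : St L Q)
    (hm : s.m = codeRow (l, b) ++ rest) :
    Run moveRow s {s with m := rest, n := (codeRow (l, b)).reverse ++ s.n} (2 * l.length + 2) := by
  induction l generalizing s with
  | nil => exact Run.of_eq (.cons_last hm rfl .push) (by simp [codeRow]) (by simp)
  | cons a l ih =>
    refine Run.of_eq (.cons_next hm rfl .push (ih _ (by rfl))) (by simp [codeRow]) ?_
    simp only [List.length_cons]; omega

/-- Moves the bits of a row from `m` to `h` and its mark to `p`. -/
def splitRow : Cmd (Alph L Q) := .loop .m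
  (fun | some (.bit b) => .push .h (.bit b) | some a => .push .p a | none => .skip)
  (fun | some (.bit _) => true | _ => false)

theorem run_splitRow (l : List Bool) {b : Bool} {rest : List Tok} (s : St L Q)
    (hm : s.m = codeRow (l, b) ++ rest) :
    Run splitRow s {s with m := rest, h := (l.map .bit).reverse ++ s.h, p := .mark b :: s.p}
      (2 * l.length + 2) := by
  induction l generalizing s with
  | nil => exact Run.of_eq (.cons_last hm rfl .push) (by simp) (by simp)
  | cons a l ih =>
    refine Run.of_eq (.cons_next hm rfl .push (ih _ (by rfl))) (by simp) ?_
    simp only [List.length_cons]; omega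

/-- Moves a row from `m` to `n`, adding the pivot row; moves the bits of the pivot row to `h`. -/
def addPivot : Cmd (Alph L Q) := .loop .m
  (fun
    | some (.bit b) => popCase .p fun
      | some (.bit a) => .seq (.push .h (.bit a)) (.push .n (.bit (xor b a)))
      | _ => .skip
    | some a => .push .n a
    | none => .skip)
  (fun | some (.bit _) => true | _ => false)

theorem run_addPivot (l q : List Bool) {b : Bool} {rest pr : List Tok} (s : St L Q)
    (hlq : l.length = q.length) (hm : s.m = codeRow (l, b) ++ rest)
    (hp : s.p = q.map .bit ++ pr) :
    Run addPivot s {s with m := rest, n := (codeRow (List.zipWith xor l q, b)).reverse ++ s.n,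
                           h := (q.map .bit).reverse ++ s.h, p := pr} (4 * l.length + 2) := by
  induction l generalizing q s with
  | nil =>
    obtain rfl : q = [] := List.length_eq_zero_iff.1 hlq.symm
    exact Run.of_eq (.cons_last hm rfl .push) (by ext1 <;> simp [codeRow, hp]) (by simp)
  | cons a l ih =>
    cases q with
    | nil => simp at hlq
    | cons c q =>
      refine Run.of_eq (.cons_next hm rfl (.popCase_cons hp (.seq .push .push))
        (ih q _ (by simpa using hlq) (by rfl) (by rfl))) (by simp [codeRow]) ?_
      simp only [List.length_cons]; omega

/-- The code of an optional row. -/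
def codePivot (p : Option (List Bool × Bool)) : List Tok := p.elim [] codeRow

/-- Eliminates the first column, moving the remaining rows from `m` to `n`. -/
def passLoop : Cmd (Alph L Q) := forEach .m fun
  | .bit false => moveRow
  | .bit true => popCase .p fun
    | none => .seq splitRow hToP
    | some a => .seq (.push .p a) (.seq addPivot hToP)
  | _ => .skip

/-- Emptiness of `p` records that no pivot has been found yet. Every row is handled in time linear
in its width. -/
theorem run_passLoop {n : ℕ} (rows : List (List Bool × Bool)) (p : Option (List Bool × Bool))
    (s : St L Q) (h : IsWidth (n + 1) rows) (hp : ∀ q ∈ p, q.1.length = n)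
    (hm : s.m = codeRows rows) (hsp : s.p = codePivot p) (hh : s.h = []) :
    Run passLoop s {s with
      m := [], p := codePivot (elimStep p rows).1,
      n := (codeRows (elimStep p rows).2).reverse ++ s.n} (rows.length * (6 * n + 10) + 2) := by
  induction rows generalizing p s with
  | nil =>
    exact Run.of_eq (.forEach_nil hm) (by ext1 <;> simp [hm, hsp, elimStep, codeRows]) (by simp)
  | cons r rows ih =>
    obtain ⟨⟨⟩ | ⟨b, l⟩, mk⟩ := r
    · simpa using h _ (List.mem_cons_self ..)
    have hl : l.length = n := by simpa using h _ (List.mem_cons_self ..)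
    have hr : IsWidth (n + 1) rows := fun r hr => h r (List.mem_cons_of_mem _ hr)
    have hm' : s.m = .bit b :: (codeRow (l, mk) ++ codeRows rows) := by
      simpa [codeRows, codeRow] using hm
    have ht : (rows.length + 1) * (6 * n + 10) = rows.length * (6 * n + 10) + (6 * n + 10) := by
      ring
    cases b with
    | false =>
      refine Run.of_eq (.forEach_cons hm' (run_moveRow l _ (by rfl))
        (ih p _ hr hp (by rfl) hsp hh)) ?_ ?_
      · simp [elimStep, codeRows]
      · simp only [List.length_cons]; omega
    | true =>
      cases p with
      | none =>
        refine Run.of_eq (.forEach_cons hm' (.popCase_nil hsp (.seq (run_splitRow l _ (by rfl))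
          (run_hToP (l.map .bit).reverse _ (by simp [hh]))))
          (ih (some (l, mk)) _ hr (by simpa using hl) (by rfl) ?_ (by rfl))) ?_ ?_
        · have : s.p = [] := hsp
          simp [codePivot, codeRow, this]
        · simp [elimStep, hh]
        · simp only [List.length_cons, List.length_reverse, List.length_map]; omega
      | some q =>
        have hq : q.1.length = n := hp q rfl
        obtain ⟨a, pl, hpl⟩ : ∃ a pl, codePivot (some q) = a :: pl := by
          refine List.exists_cons_of_ne_nil ?_
          simp [codePivot, codeRow]
        -- The test for a pivot consumed the symbol `a`, which is pushed back. `addPivot` leaves the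
        -- mark of the pivot in `p`, so returning the bits from `h` restores the pivot row.
        refine Run.of_eq (.forEach_cons hm' (.popCase_cons (hsp.trans hpl) (.seq .push
          (.seq (run_addPivot l q.1 _ (hl.trans hq.symm) (by rfl) (pr := [.mark q.2])
              (by simp [← hpl, codePivot, codeRow]))
          (run_hToP (q.1.map .bit).reverse _ (by simp [hh])))))
          (ih (some q) _ hr hp (by rfl) ?_ (by rfl))) ?_ ?_
        · simp [codePivot, codeRow]
        · simp [elimStep, hh, codeRows]
        · simp only [List.length_cons, List.length_reverse, List.length_map]; omega

/-- Clears `p`, moving the mark of the pivot row to `r`. -/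
def pivotMark : Cmd (Alph L Q) := forEach .p fun
  | .mark b => .push .r (.mark b)
  | _ => .skip

theorem run_pivotMark (l : List Bool) (b : Bool) (s : St L Q) (hp : s.p = codeRow (l, b)) :
    Run pivotMark s {s with p := [], r := .mark b :: s.r} (2 * l.length + 4) := by
  induction l generalizing s with
  | nil => exact Run.of_eq (.forEach_cons hp .push (.forEach_nil rfl)) (by simp) (by simp)
  | cons a l ih =>
    refine Run.of_eq (.forEach_cons hp .skip (ih _ (by rfl))) (by simp) ?_
    simp only [List.length_cons]; omega

/-- Eliminates the first column. -/
def pass : Cmd (Alph L Q) := .seq passLoop (.seq nToM pivotMark)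

theorem run_pass {n : ℕ} (rows : List (List Bool × Bool)) (acc : List Bool) (s : St L Q)
    (h : IsWidth (n + 1) rows) (hm : s.m = codeRows rows) (hp : s.p = []) (hh : s.h = [])
    (hn : s.n = []) (hr : s.r = acc.map .mark) :
    Run pass s {s with
      m := codeRows (elimStep none rows).2,
      r := ((elimStep none rows).1.elim acc fun q => q.2 :: acc).map .mark}
      ((rows.length + 1) * (8 * n + 12)) := by
  obtain ⟨h1, h2, h3⟩ := elimStep_width rows none h (by simp)
  have h4 := run_passLoop rows none s h (by simp) hm hp hh
  have h5 := run_nToM (codeRows (elimStep none rows).2).reverse _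
    (show St.n {s with
      m := [], p := codePivot (elimStep none rows).1,
      n := (codeRows (elimStep none rows).2).reverse ++ s.n} = _ by simp [hn])
  have h6 : Run pivotMark {s with m := codeRows (elimStep none rows).2,
                                  p := codePivot (elimStep none rows).1}
      {s with m := codeRows (elimStep none rows).2,
              r := ((elimStep none rows).1.elim acc fun q => q.2 :: acc).map .mark}
      (2 * n + 4) := by
    cases hq : (elimStep none rows).1 with
    | none => exact Run.of_eq (.forEach_nil rfl) (by ext1 <;> simp [hp, hr, codePivot]) (by omega)
    | some q =>
      refine Run.of_eq (run_pivotMark q.1 q.2 _ (by simp [codePivot])) (by simp [hp, hr]) ?_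
      have := h3 q hq
      omega
  refine Run.weaken (.seq h4 (.seq (by simpa [hn] using h5) h6)) ?_
  have h7 := length_codeRows h1
  have h8 := Nat.mul_le_mul_right (n + 1) h2
  rw [List.length_reverse] at *
  rw [h7]
  nlinarith

/-- Eliminates a column for each equation in `f`. -/
def eliminate : Cmd (Alph L Q) := forEach .f fun
  | .eqn _ => pass
  | _ => .skip

/-- Whether a symbol starts an equation. -/
def Tok.isEqn : Tok → Bool
  | .eqn _ => true
  | _ => false

/-- `B` and `W` bound the numbers of rows and columns in all passes, which gives one cost for each.
After the last pass the rows have width 0, so only marks are left in `m`, at most `B` of them. -/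
theorem run_eliminate (l : List Tok) (B W : ℕ) (rows : List (List Bool × Bool)) (acc : List Bool)
    (s : St L Q) (h : IsWidth (l.countP Tok.isEqn) rows) (hB : rows.length ≤ B)
    (hW : l.countP Tok.isEqn ≤ W) (hf : s.f = l)
    (hm : s.m = codeRows rows) (hp : s.p = []) (hh : s.h = [])
    (hn : s.n = []) (hr : s.r = acc.map .mark) :
    ∃ m', m'.length ≤ B ∧ Run eliminate s {s with
      f := [], m := m', r := (elim (l.countP Tok.isEqn) rows acc).map .mark}
      (l.length * ((B + 1) * (8 * W + 12) + 2) + 2) := by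
  induction l generalizing rows acc s with
  | nil =>
    refine ⟨codeRows rows, ?_, Run.of_eq (.forEach_nil hf) (by ext1 <;> simp [hf, hr, elim, hm])
      (by simp)⟩
    rw [length_codeRows h]
    simpa using hB
  | cons a l ih =>
    have ht : (l.length + 1) * ((B + 1) * (8 * W + 12) + 2) =
      l.length * ((B + 1) * (8 * W + 12) + 2) + (B + 1) * (8 * W + 12) + 2 := by ring
    cases ha : a.isEqn with
    | false =>
      rw [List.countP_cons_of_neg (by simp [ha])] at *
      obtain ⟨m', h1, h2⟩ := ih rows acc {s with f := l} h hB hW rfl hm hp hh hn hr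
      refine ⟨m', h1, Run.of_eq (.forEach_cons hf (t := 1) ?_ h2) rfl ?_⟩
      · cases a with
        | eqn b => cases ha
        | _ => exact .skip
      · simp only [List.length_cons]; omega
    | true =>
      rw [List.countP_cons_of_pos ha] at *
      have h3 := elimStep_width rows none h (by simp)
      obtain ⟨m', h1, h2⟩ := ih _ _ {s with
        f := l, m := codeRows (elimStep none rows).2,
        r := ((elimStep none rows).1.elim acc fun q => q.2 :: acc).map .mark}
        h3.1 (h3.2.1.trans hB) (by omega) rfl rfl hp hh hn rfl
      refine ⟨m', h1, Run.of_eq (.forEach_cons hf (t := (B + 1) * (8 * W + 12)) ?_ h2) rfl ?_⟩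
      · cases a with
        | eqn b =>
          refine Run.weaken (run_pass rows acc _ h hm hp hh hn hr) ?_
          gcongr
          omega
        | _ => cases ha
      · simp only [List.length_cons]; omega

theorem countP_isEqn (E : List (Bool × List (List Bool))) :
    (codeSys E).countP Tok.isEqn = E.length := by
  have hname (y : List Bool) : (codeName y).countP Tok.isEqn = 0 := by
    simp [codeName, Tok.isEqn, List.countP_eq_zero]
  have hnames (ys : List (List Bool)) : (ys.flatMap codeName).countP Tok.isEqn = 0 := by
    induction ys with
    | nil => rfl
    | cons y ys ih => simp [hname, ih]
  induction E with
  | nil => rfl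
  | cons e E ih =>
    rw [codeSys] at ih
    rw [codeSys, List.flatMap_cons, List.countP_append, ih, codeEqn,
      List.countP_cons_of_pos rfl, hnames, List.length_cons]
    omega

variable {L Q : Type}

/-! ### Comparing the rank with the bound -/

/-- The number with a given binary code. -/
def binVal (l : List Bool) : ℕ := l.foldr (fun b n => b.toNat + 2 * n) 0

@[simp] theorem binVal_nil : binVal [] = 0 := rfl

@[simp] theorem binVal_cons (b : Bool) (l : List Bool) :
    binVal (b :: l) = b.toNat + 2 * binVal l := rfl

/-- Decrements the lowest part of the number in `k`, which is moved to `h`; logs an underflow in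
`e`. -/
def decLoop : Cmd (Alph L Q) := .loop .k
  (fun
    | some (.bit b) => .push .h (.bit !b)
    | some _ => .skip
    | none => .push .e (.mark false))
  (fun | some (.bit false) => true | _ => false)

/-- Low bits come first: the borrow turns leading `false` bits into `true` and stops at the first
`true`. If there is none, the number was zero and the underflow is logged. The number of bits never
changes, so the result may have leading zeros, which `binVal` tolerates. -/
theorem run_decLoop (l : List Bool) (s : St L Q) (hk : s.k = l.map .bit) :
    ∃ l₁ l₂ : List Bool, ∃ e', Run decLoop s
      {s with k := l₂.map .bit, h := (l₁.map .bit).reverse ++ s.h, e := e'} (2 * l.length + 2) ∧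
      l₁.length + l₂.length = l.length ∧
      (binVal l = 0 ∧ e' = .mark false :: s.e ∨ binVal (l₁ ++ l₂) + 1 = binVal l ∧ e' = s.e) := by
  induction l generalizing s with
  | nil =>
    exact ⟨[], [], _, Run.of_eq (.nil_last hk rfl .push) (by ext1 <;> simp [hk]) (by simp), rfl,
      Or.inl ⟨rfl, rfl⟩⟩
  | cons b l ih =>
    cases b with
    | true =>
      exact ⟨[false], l, _, Run.of_eq (.cons_last hk rfl .push) (by simp) (by simp),
        by simp; omega, Or.inr ⟨by simp; omega, rfl⟩⟩
    | false =>
      obtain ⟨l₁, l₂, e', h1, h2, h3⟩ := ih {s with k := l.map .bit, h := .bit true :: s.h} rfl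
      refine ⟨true :: l₁, l₂, e', Run.of_eq (.cons_next hk rfl .push h1) (by simp) ?_, ?_, ?_⟩
      · simp only [List.length_cons]; omega
      · simp only [List.length_cons]; omega
      · rcases h3 with h3 | h3
        · exact Or.inl ⟨by simp [h3.1], h3.2⟩
        · exact Or.inr ⟨by
            simp only [List.cons_append, binVal_cons, Bool.toNat_true, Bool.toNat_false]
            omega, h3.2⟩

/-- Decrements the number in `k` once for each symbol in `n`; logs underflows in `e`. -/
def decAll : Cmd (Alph L Q) := forEach .n fun _ => .seq decLoop hToK

theorem run_decAll (c : List Tok) (l : List Bool) (s : St L Q) (hn : s.n = c)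
    (hk : s.k = l.map .bit) (hh : s.h = []) :
    ∃ l' : List Bool, ∃ e', Run decAll s {s with n := [], k := l'.map .bit, e := e'}
        (c.length * (4 * l.length + 10) + 2) ∧
      l'.length = l.length ∧ e'.length ≤ s.e.length + c.length ∧
      (e' = [] ↔ s.e = [] ∧ c.length ≤ binVal l) := by
  induction c generalizing l s with
  | nil =>
    exact ⟨l, s.e, Run.of_eq (.forEach_nil hn) (by ext1 <;> simp [hn, hk]) (by simp), rfl, by simp,
      by simp⟩
  | cons a c ih =>
    obtain ⟨l₁, l₂, e₁, h1, h2, h3⟩ := run_decLoop l {s with n := c} hk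
    obtain ⟨l', e', h4, h5, h6, h7⟩ := ih (l₁ ++ l₂)
      {s with n := c, k := (l₁ ++ l₂).map .bit, e := e₁} rfl rfl hh
    have h8 := run_hToK (l₁.map .bit).reverse
      (St.mk s.inp s.out s.q s.f s.g s.o (l₂.map .bit) s.x s.y (l₁.map .bit).reverse e₁ s.m c s.p
        s.r) rfl
    rw [List.length_append, h2] at h4
    refine ⟨l', e', Run.of_eq (.forEach_cons hn (.seq h1 (by simpa [hh] using h8)) h4) ?_ ?_,
      ?_, ?_, ?_⟩
    · simp
    · have : l₁.length ≤ l.length := by omega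
      simp only [List.length_cons, add_mul]; omega
    · rw [h5, List.length_append, h2]
    · rcases h3 with h3 | h3 <;> simp [h3.2] at h6 ⊢ <;> omega
    · rw [h7]
      rcases h3 with h3 | h3 <;> simp [h3.2]
      · intro; omega
      · intro; omega

/-- Moves the marks of the pivots from `r` to `n`; logs set marks in `e`. -/
def checkMarks : Cmd (Alph L Q) := forEach .r fun a =>
  .seq (.push .n a) (if a = .mark true then .push .e a else .skip)

theorem run_checkMarks (R : List Bool) (s : St L Q) (hr : s.r = R.map .mark) :
    ∃ e', Run checkMarks s {s with r := [], n := (R.map .mark).reverse ++ s.n, e := e'}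
      (3 * R.length + 2) ∧ e'.length ≤ s.e.length + R.length ∧
      (e' = [] ↔ s.e = [] ∧ true ∉ R) := by
  induction R generalizing s with
  | nil => exact ⟨s.e, Run.of_eq (.forEach_nil hr) (by ext1 <;> simp [hr]) (by simp), by simp,
      by simp⟩
  | cons b R ih =>
    cases b with
    | true =>
      obtain ⟨e', h1, h2, h3⟩ := ih {s with
        r := R.map .mark, n := .mark true :: s.n, e := .mark true :: s.e} rfl
      refine ⟨e', Run.of_eq (.forEach_cons hr (.seq .push .push) h1) (by simp) ?_, ?_, ?_⟩
      · simp only [List.length_cons]; omega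
      · simp at h2 ⊢; omega
      · simp [h3]
    | false =>
      obtain ⟨e', h1, h2, h3⟩ := ih {s with r := R.map .mark, n := .mark false :: s.n} rfl
      refine ⟨e', Run.of_eq (.forEach_cons hr (.seq .push .skip) h1) (by simp) ?_, ?_, ?_⟩
      · simp only [List.length_cons]; omega
      · simp at h2 ⊢; omega
      · simp [h3]

/-- Pushes `c` symbols to `n`. -/
def pushUnits : ℕ → Cmd (Alph L Q)
  | 0 => .skip
  | c + 1 => .seq (.push .n (.mark false)) (pushUnits c)

theorem run_pushUnits (c : ℕ) (s : St L Q) :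
    Run (pushUnits c) s {s with n := List.replicate c (.mark false) ++ s.n} (c + 1) := by
  induction c generalizing s with
  | zero => exact Run.of_eq .skip (by simp) (by simp)
  | succ c ih =>
    refine Run.of_eq (.seq .push (ih _)) ?_ (by omega)
    rw [List.replicate_succ']
    simp

/-- Compares the number in `k` with the number of marks in `r` or, if one of them is set, with
`c`. -/
def compare (c : ℕ) : Cmd (Alph L Q) :=
  .seq checkMarks <| .seq
    (popCase .e fun
      | some _ => .seq (clear .e) (.seq (clear .n) (pushUnits c))
      | none => .skip)
    decAll

/-- A set mark means an inconsistent system; the units counted in `n` are then replaced by `c` of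
them. The decrements stay free of underflow iff their number is at most the bound. -/
theorem run_compare (c : ℕ) (R κ : List Bool) (s : St L Q) (hr : s.r = R.map .mark)
    (hk : s.k = κ.map .bit) (hn : s.n = []) (hh : s.h = []) (he : s.e = []) :
    ∃ κ' : List Bool, ∃ e', Run (compare c) s {s with r := [], k := κ'.map .bit, e := e'}
        (10 * R.length + c + 20 + (R.length + c) * (4 * κ.length + 10)) ∧
      κ'.length = κ.length ∧ e'.length ≤ R.length + c ∧
      (e' = [] ↔ (if true ∈ R then c else R.length) ≤ binVal κ) := by
  obtain ⟨e₁, h1, h2, h3⟩ := run_checkMarks R s hr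
  simp only [he, true_and, List.length_nil, zero_add] at h2 h3
  have hmul (a : ℕ) (ha : a ≤ R.length + c) :
      a * (4 * κ.length + 10) ≤ (R.length + c) * (4 * κ.length + 10) := Nat.mul_le_mul_right _ ha
  cases e₁ with
  | nil =>
    have hR : true ∉ R := h3.1 rfl
    obtain ⟨κ', e', h4, h5, h6, h7⟩ := run_decAll (R.map .mark).reverse κ
      {s with r := [], n := (R.map .mark).reverse ++ s.n, e := []} (by simp [hn]) hk hh
    refine ⟨κ', e', Run.of_eq (.seq h1 (.seq (.popCase_nil rfl .skip) h4)) ?_ ?_, h5, ?_, ?_⟩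
    · simp [hn]
    · have := hmul R.length (by omega)
      simp; omega
    · simp at h6; omega
    · simp [h7, hR]
  | cons a e₁ =>
    have hR : true ∈ R := by simpa using h3
    obtain ⟨κ', e', h4, h5, h6, h7⟩ := run_decAll (List.replicate c (.mark false)) κ
      {s with r := [], n := List.replicate c (.mark false), e := []} rfl hk hh
    refine ⟨κ', e', Run.of_eq (.seq h1 (.seq (.popCase_cons rfl (.seq (.clear_all _ _)
      (.seq (.clear_all _ _) (Run.of_eq (run_pushUnits c _) ?_ le_rfl)))) h4)) ?_ ?_, h5, ?_, ?_⟩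
    · simp
    · simp [hn]
    · have := hmul c (by omega)
      simp at h2
      simp [hn]; omega
    · simp at h6; omega
    · simp [h7, hR]

theorem length_elim_le (n : ℕ) (rows : List (List Bool × Bool)) (acc : List Bool) :
    (elim n rows acc).length ≤ n + acc.length := by
  induction n generalizing rows acc with
  | zero => simp [elim]
  | succ n ih =>
    refine (ih _ _).trans ?_
    cases (elimStep none rows).1 with
    | none => simp
    | some q => simp; omega

/-- The outcome of the computation on a system: its rank or, if it is inconsistent, `c`. -/
def outcome (c : ℕ) (E : List (Bool × List (List Bool))) : ℕ :=
  if true ∈ elim E.length (matrixRows E) [] then c else (elim E.length (matrixRows E) []).length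

/-- Compares the rank of the system in `g` with the number in `g`. -/
def work (c : ℕ) : Cmd (Alph L Q) := .seq buildMatrix (.seq eliminate (compare c))

theorem isWidth_matrixRows (E : List (Bool × List (List Bool))) :
    IsWidth E.length (matrixRows E) := by
  intro r hr
  simp only [matrixRows, List.mem_append, List.mem_reverse, List.mem_map, List.mem_singleton] at hr
  rcases hr with ⟨x, _, rfl⟩ | rfl <;> simp [rowOf, coeffs]

theorem length_matrixRows_le (E : List (Bool × List (List Bool))) :
    (matrixRows E).length ≤ (codeSys E).length + 1 := by
  have hnames (ys : List (List Bool)) : ys.length ≤ (ys.flatMap codeName).length := by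
    induction ys with
    | nil => simp
    | cons y ys ih => simp [codeName] at ih ⊢; omega
  suffices h : (E.flatMap Prod.snd).length ≤ (codeSys E).length by simpa [matrixRows] using h
  induction E with
  | nil => simp
  | cons e E ih =>
    have := hnames e.2
    simp only [codeSys, codeEqn, List.flatMap_cons, List.length_append, List.length_cons] at ih ⊢
    omega

theorem run_work (c N : ℕ) (E : List (Bool × List (List Bool))) (κ : List Bool)
    (hN : (codeSys E).length + κ.length + 1 ≤ N) :
    ∃ k' e' m' : List Tok, Run (work c)
        ({g := (codeSys E ++ Tok.mark true :: κ.map Tok.bit).reverse} : St L Q)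
        {k := k', e := e', m := m'} ((200 + 20 * c) * N ^ 3) ∧
      k'.length ≤ N ∧ e'.length ≤ N + c ∧ m'.length ≤ N ∧
      (e' = [] ↔ outcome c E ≤ binVal κ) := by
  have hE : E.length ≤ (codeSys E).length := by
    rw [← countP_isEqn E]; exact List.countP_le_length
  obtain ⟨m', h1, h2⟩ := run_eliminate (codeSys E) N N (matrixRows E) []
    ({f := codeSys E, k := κ.map .bit, m := codeRows (matrixRows E)} : St L Q)
    (by rw [countP_isEqn]; exact isWidth_matrixRows E)
    ((length_matrixRows_le E).trans (by omega))
        (by rw [countP_isEqn]; omega) rfl rfl rfl rfl rfl rfl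
  rw [countP_isEqn] at h2
  have h3 := length_elim_le E.length (matrixRows E) []
  obtain ⟨κ', e', h4, h5, h6, h7⟩ := run_compare c (elim E.length (matrixRows E) []) κ
    ({k := κ.map .bit, m := m', r := (elim E.length (matrixRows E) []).map .mark} : St L Q)
    rfl rfl rfl rfl rfl
  simp only [List.length_nil, add_zero] at h3
  refine ⟨κ'.map .bit, e', m', Run.of_eq (.seq (run_buildMatrix E κ) (.seq h2 h4)) rfl ?_,
    by simp; omega, by omega, h1, h7⟩
  have hS : (codeSys E).length + 1 ≤ N := by omega
  have hR : (elim E.length (matrixRows E) []).length ≤ N := by omega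
  have hκ : κ.length ≤ N := by omega
  have hN1 : 1 ≤ N := by omega
  calc _ ≤ 2 * N + 32 * N ^ 2 + (N * ((N + 1) * (8 * N + 12) + 2) + 2 +
      (10 * N + c + 20 + (N + c) * (4 * N + 10))) := by gcongr; omega
    _ ≤ _ := by
      have h1 : N ≤ N ^ 3 := Nat.le_self_pow (by omega) N
      have h2 : N ^ 2 ≤ N ^ 3 := Nat.pow_le_pow_right hN1 (by omega)
      have h3 : 1 ≤ N ^ 3 := Nat.one_le_pow _ _ hN1
      have h4 : c * N ≤ c * N ^ 3 := Nat.mul_le_mul_left c h1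
      have h5 : c ≤ c * N ^ 3 := by nlinarith
      nlinarith

/-! ### Parsing -/

/-- Runs an automaton with transition function `δ` on the input; the output goes to `g`. -/
def parse (δ : Q → L → Q) (em : Q → L → Option Tok) : Cmd (Alph L Q) := forEach .inp fun a =>
  popCase .q fun
    | some s => .seq (.push .q (δ s a)) (match em s a with | some t => .push .g t | none => .skip)
    | none => .skip

/-- The output of an automaton. -/
def emitted (δ : Q → L → Q) (em : Q → L → Option Tok) : Q → List L → List Tok
  | _, [] => []
  | q, a :: w => (em q a).toList ++ emitted δ em (δ q a) w

theorem run_parse (δ : Q → L → Q) (em : Q → L → Option Tok) (w : List L) (q : Q) (s : St L Q)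
    (hw : s.inp = w) (hq : s.q = [q]) :
    Run (parse δ em) s {s with
      inp := [], q := [w.foldl δ q], g := (emitted δ em q w).reverse ++ s.g}
      (4 * w.length + 2) := by
  induction w generalizing q s with
  | nil => exact Run.of_eq (.forEach_nil hw) (by ext1 <;> simp [hw, hq, emitted]) (by simp)
  | cons a w ih =>
    cases he : em q a with
    | none =>
      refine Run.of_eq (.forEach_cons hw (.popCase_cons hq (.seq (t' := 1) .push
        (by rw [he]; exact .skip))) (ih _ _ (by rfl) (by rfl))) (by simp [emitted, he]) ?_
      simp only [List.length_cons]; omega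
    | some t =>
      refine Run.of_eq (.forEach_cons hw (.popCase_cons hq (.seq (t' := 1) .push
        (by rw [he]; exact .push))) (ih _ _ (by rfl) (by rfl))) (by simp [emitted, he]) ?_
      simp only [List.length_cons]; omega

theorem length_emitted_le (δ : Q → L → Q) (em : Q → L → Option Tok) (w : List L) (q : Q) :
    (emitted δ em q w).length ≤ w.length := by
  induction w generalizing q with
  | nil => simp [emitted]
  | cons a w ih =>
    have := ih (δ q a)
    cases h : em q a <;> simp [emitted, h] <;> omega

/-- Writes the output and empties the work stacks. -/
def finish : Cmd (Alph L Q) :=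
  .seq (popCase .e fun
    | some _ => .push .out false
    | none => .push .out true) <|
  .seq (clear .e) <| .seq (clear .g) <| .seq (clear .m) (clear .k)

theorem run_finish (g k e m : List Tok) :
    Run finish ({g := g, k := k, e := e, m := m} : St L Q) {out := [decide (e = [])]}
      (2 * (g.length + k.length + e.length + m.length) + 20) := by
  have h (b : Bool) (e : List Tok) : Run
      (.seq (clear .e) <| .seq (clear .g) <| .seq (clear .m) (clear .k))
      ({out := [b], g := g, k := k, e := e, m := m} : St L Q) {out := [b]}
      (2 * (g.length + k.length + e.length + m.length) + 8) := by
    refine Run.of_eq (.seq (.clear_all _ _) (.seq (.clear_all _ _) (.seq (.clear_all _ _)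
      (.clear_all _ _)))) rfl ?_
    simp only [St.get, St.set]
    omega
  cases e with
  | nil =>
    refine Run.of_eq (.seq (.popCase_nil rfl .push) (h true [])) (by simp) (by simp; omega)
  | cons a e =>
    refine Run.of_eq (.seq (.popCase_cons rfl .push) (h false e)) (by simp) (by simp; omega)

/-- The whole program. -/
def decider (δ : Q → L → Q) (em : Q → L → Option Tok) (q₀ : Q) (acc : Q → Bool) (c : ℕ) :
    Cmd (Alph L Q) :=
  .seq (.push .q q₀) <| .seq (parse δ em) <| .seq
    (popCase .q fun
      | some q => if acc q then work c else .push .e (.mark false)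
      | none => .skip)
    finish

/-- The symbol pushed to `e` on rejection makes `finish` answer `false`. -/
theorem run_decider_reject (δ : Q → L → Q) (em : Q → L → Option Tok) (q₀ : Q) (acc : Q → Bool)
    (c : ℕ) (w : List L) (hw : acc (w.foldl δ q₀) = false) :
    Run (decider δ em q₀ acc c) {inp := w} {out := [false]}
      ((300 + 30 * c) * (w.length + 1) ^ 3) := by
  refine Run.of_eq (.seq .push
      (.seq (run_parse δ em w q₀ _ rfl rfl) (.seq (.popCase_cons rfl (t := 1) ?_)
    (run_finish (emitted δ em q₀ w).reverse [] [.mark false] [])))) (by simp) ?_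
  · simp only [hw]
    exact Run.of_eq .push (by simp) le_rfl
  · have := length_emitted_le δ em w q₀
    have h1 : w.length + 1 ≤ (w.length + 1) ^ 3 := Nat.le_self_pow (by omega) _
    simp only [List.length_reverse, List.length_nil, List.length_cons]
    nlinarith

theorem run_decider_accept (δ : Q → L → Q) (em : Q → L → Option Tok) (q₀ : Q) (acc : Q → Bool)
    (c : ℕ) (w : List L) (hw : acc (w.foldl δ q₀) = true)
    (E : List (Bool × List (List Bool))) (κ : List Bool)
    (hE : emitted δ em q₀ w = codeSys E ++ Tok.mark true :: κ.map Tok.bit) :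
    Run (decider δ em q₀ acc c) {inp := w} {out := [decide (outcome c E ≤ binVal κ)]}
      ((300 + 30 * c) * (w.length + 1) ^ 3) := by
  have hlen := length_emitted_le δ em w q₀
  rw [hE] at hlen
  simp only [List.length_append, List.length_cons, List.length_map] at hlen
  obtain ⟨k', e', m', h1, h2, h3, h4, h5⟩ := run_work (L := L) (Q := Q) c (w.length + 1) E κ
    (by omega)
  refine Run.of_eq (.seq .push (.seq (run_parse δ em w q₀ _ rfl rfl) (.seq (.popCase_cons rfl
    (t := (200 + 20 * c) * (w.length + 1) ^ 3) ?_) (run_finish [] k' e' m')))) (by simp [h5]) ?_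
  · simp only [hw]
    simpa [hE] using h1
  · have h1 : w.length + 1 ≤ (w.length + 1) ^ 3 := Nat.le_self_pow (by omega) _
    simp only [List.length_nil]
    nlinarith

/-! ### Correctness of the elimination -/

/-- Booleans as elements of the field with two elements. -/
def bz (b : Bool) : ZMod 2 := if b then 1 else 0

@[simp] theorem bz_true : bz true = 1 := rfl
@[simp] theorem bz_false : bz false = 0 := rfl

theorem bz_xor (a b : Bool) : bz (xor a b) = bz a + bz b := by
  cases a <;> cases b <;> decide

/-- A list of bits as a vector, padded by zeros. -/
def bitVec (l : List Bool) : ℕ → ZMod 2 := fun i => bz (l.getD i false)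

/-- The right shift. -/
def shift : (ℕ → ZMod 2) →ₗ[ZMod 2] (ℕ → ZMod 2) where
  toFun v i := Nat.casesOn i 0 v
  map_add' u v := by funext i; cases i <;> simp
  map_smul' a v := by funext i; cases i <;> simp

@[simp] theorem shift_zero (v : ℕ → ZMod 2) : shift v 0 = 0 := rfl

@[simp] theorem shift_succ (v : ℕ → ZMod 2) (i : ℕ) : shift v (i + 1) = v i := rfl

theorem shift_injective : Injective shift := fun u v h => by
  funext i
  simpa using congrFun h (i + 1)

theorem finrank_map_shift (S : Submodule (ZMod 2) (ℕ → ZMod 2)) :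
    Module.finrank (ZMod 2) (S.map shift) = Module.finrank (ZMod 2) S :=
  (Submodule.equivMapOfInjective shift shift_injective S).finrank_eq.symm

@[simp] theorem bitVec_nil : bitVec [] = 0 := by funext i; simp [bitVec]

theorem bitVec_cons (b : Bool) (l : List Bool) :
    bitVec (b :: l) = bz b • Pi.single 0 1 + shift (bitVec l) := by
  funext i
  cases i <;> simp [bitVec]

theorem bitVec_xor (l q : List Bool) (h : l.length = q.length) :
    bitVec (List.zipWith xor l q) = bitVec l + bitVec q := by
  induction l generalizing q with
  | nil => simp [List.length_eq_zero_iff.1 h.symm]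
  | cons a l ih =>
    cases q with
    | nil => simp at h
    | cons b q =>
      rw [List.zipWith_cons_cons, bitVec_cons, bitVec_cons, bitVec_cons, ih q (by simpa using h),
        bz_xor, map_add, add_smul]
      abel

/-- The span of the rows. -/
def rowSpan (rows : List (List Bool × Bool)) : Submodule (ZMod 2) (ℕ → ZMod 2) :=
  Submodule.span (ZMod 2) {v | ∃ r ∈ rows, bitVec r.1 = v}

@[simp] theorem rowSpan_nil : rowSpan [] = ⊥ := by simp [rowSpan]

theorem rowSpan_cons (r : List Bool × Bool) (rows : List (List Bool × Bool)) :
    rowSpan (r :: rows) = Submodule.span (ZMod 2) {bitVec r.1} ⊔ rowSpan rows := by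
  rw [rowSpan, rowSpan, ← Submodule.span_union]
  congr 1
  ext v
  simp [eq_comm]

instance (rows : List (List Bool × Bool)) : FiniteDimensional (ZMod 2) (rowSpan rows) :=
  FiniteDimensional.span_of_finite _
    ((List.finite_toSet rows).image (fun r => bitVec r.1) |>.subset
      (by rintro v ⟨r, hr, rfl⟩; exact ⟨r, hr, rfl⟩))

/-- The pivot vector of a pivot row without its first entry. -/
def pivotVec (q : List Bool × Bool) : ℕ → ZMod 2 := Pi.single 0 1 + shift (bitVec q.1)

theorem span_sup_span_add {M : Type*} [AddCommGroup M] [Module (ZMod 2) M] (w u : M) :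
    Submodule.span (ZMod 2) {w} ⊔ Submodule.span (ZMod 2) {w + u} =
      Submodule.span (ZMod 2) {w} ⊔ Submodule.span (ZMod 2) {u} := by
  apply le_antisymm <;> refine sup_le le_sup_left ?_ <;>
    rw [Submodule.span_singleton_le_iff_mem]
  · exact add_mem (Submodule.mem_sup_left (Submodule.mem_span_singleton_self w))
      (Submodule.mem_sup_right (Submodule.mem_span_singleton_self u))
  · have := sub_mem (Submodule.mem_sup_right (S := Submodule.span (ZMod 2) {w})
      (Submodule.mem_span_singleton_self (w + u)))
      (Submodule.mem_sup_left (Submodule.mem_span_singleton_self w))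
    simpa using this

/-- In characteristic two the tail of the pivot, added twice, cancels. -/
theorem shift_bitVec_xor (l : List Bool) (q : List Bool × Bool) (h : l.length = q.1.length) :
    bitVec (true :: l) = pivotVec q + shift (bitVec (List.zipWith xor l q.1)) := by
  rw [bitVec_cons, bitVec_xor l q.1 h, pivotVec, map_add, bz_true, one_smul]
  have : shift (bitVec q.1) + shift (bitVec q.1) = 0 := CharTwo.add_self_eq_zero _
  calc _ = Pi.single 0 1 + shift (bitVec l) + (shift (bitVec q.1) + shift (bitVec q.1)) := by
        rw [this, add_zero]
    _ = _ := by abel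

/-- Modulo the pivot, a row starting with 1 may be replaced by its sum with the pivot, whose first
entry is 0. So each remaining row is a shifted vector, up to a multiple of the pivot. -/
theorem elimStep_some {n : ℕ} (rows : List (List Bool × Bool)) (q : List Bool × Bool)
    (h : IsWidth (n + 1) rows) (hq : q.1.length = n) :
    (elimStep (some q) rows).1 = some q ∧
    Submodule.span (ZMod 2) {pivotVec q} ⊔ rowSpan rows =
      Submodule.span (ZMod 2) {pivotVec q} ⊔ (rowSpan (elimStep (some q) rows).2).map shift := by
  induction rows with
  | nil => exact ⟨rfl, by simp [elimStep]⟩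
  | cons r rows ih =>
    obtain ⟨h1, h2⟩ := ih fun r hr => h r (List.mem_cons_of_mem _ hr)
    obtain ⟨⟨⟩ | ⟨b, l⟩, mk⟩ := r
    · simpa using h _ (List.mem_cons_self ..)
    have hl : l.length = n := by simpa using h _ (List.mem_cons_self ..)
    cases b with
    | false =>
      refine ⟨h1, ?_⟩
      simp only [elimStep, List.headD_cons, List.tail_cons, rowSpan_cons, Submodule.map_sup,
        Submodule.map_span, Set.image_singleton]
      rw [sup_left_comm, h2, bitVec_cons, sup_left_comm]
      simp
    | true =>
      refine ⟨h1, ?_⟩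
      simp only [elimStep, List.headD_cons, List.tail_cons, rowSpan_cons, Submodule.map_sup,
        Submodule.map_span, Set.image_singleton]
      rw [shift_bitVec_xor l q (hl.trans hq.symm), ← sup_assoc, span_sup_span_add, sup_right_comm,
        h2, sup_right_comm, sup_assoc]

theorem elimStep_none {n : ℕ} (rows : List (List Bool × Bool)) (h : IsWidth (n + 1) rows) :
    rowSpan rows = ((elimStep none rows).1.elim ⊥ fun q => Submodule.span (ZMod 2) {pivotVec q}) ⊔
      (rowSpan (elimStep none rows).2).map shift := by
  induction rows with
  | nil => simp [elimStep]
  | cons r rows ih =>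
    have h' : IsWidth (n + 1) rows := fun r hr => h r (List.mem_cons_of_mem _ hr)
    obtain ⟨⟨⟩ | ⟨b, l⟩, mk⟩ := r
    · simpa using h _ (List.mem_cons_self ..)
    have hl : l.length = n := by simpa using h _ (List.mem_cons_self ..)
    cases b with
    | false =>
      simp only [elimStep, List.headD_cons, List.tail_cons, rowSpan_cons, Submodule.map_sup,
        Submodule.map_span, Set.image_singleton]
      rw [ih h', bitVec_cons, sup_left_comm]
      simp
    | true =>
      obtain ⟨h1, h2⟩ := elimStep_some rows (l, mk) h' hl
      simp only [elimStep, List.headD_cons, List.tail_cons, rowSpan_cons, h1, Option.elim_some]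
      rw [← h2, bitVec_cons]
      simp [pivotVec]

theorem elimStep_mark (rows : List (List Bool × Bool)) (p : Option (List Bool × Bool))
    (h : ∀ r ∈ rows, r.2 = false) (hp : ∀ q ∈ p, q.2 = false) :
    (∀ r ∈ (elimStep p rows).2, r.2 = false) ∧ ∀ q ∈ (elimStep p rows).1, q.2 = false := by
  induction rows generalizing p with
  | nil => exact ⟨by simp [elimStep], by simpa [elimStep] using hp⟩
  | cons r rows ih =>
    have h' : ∀ r ∈ rows, r.2 = false := fun r hr => h r (List.mem_cons_of_mem _ hr)
    have hr := h r (List.mem_cons_self ..)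
    cases hb : r.1.headD false with
    | false => simpa [elimStep, hb, hr, -List.headD_eq_head?_getD] using ih _ h' hp
    | true =>
      cases p with
      | none =>
        simpa [elimStep, hb, -List.headD_eq_head?_getD] using
          ih (some (r.1.tail, r.2)) h' (by simpa using hr)
      | some q => simpa [elimStep, hb, hr, -List.headD_eq_head?_getD] using ih _ h' hp

/-- The rows are processed from left to right, so an appended row meets the pivot chosen among the
earlier ones. -/
theorem elimStep_append (rows rows' : List (List Bool × Bool)) (p : Option (List Bool × Bool)) :
    elimStep p (rows ++ rows') = ((elimStep (elimStep p rows).1 rows').1,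
      (elimStep p rows).2 ++ (elimStep (elimStep p rows).1 rows').2) := by
  induction rows generalizing p with
  | nil => simp [elimStep]
  | cons r rows ih =>
    cases hb : r.1.headD false <;> cases p <;> simp [elimStep, hb, ih, -List.headD_eq_head?_getD]

theorem mem_elim_of_mem {b : Bool} (n : ℕ) (rows : List (List Bool × Bool)) (acc : List Bool)
    (h : b ∈ acc) : b ∈ elim n rows acc := by
  induction n generalizing rows acc with
  | zero => exact h
  | succ n ih =>
    refine ih _ _ ?_
    cases (elimStep none rows).1 <;> simp [h]

/-- Coordinate 0 is 1 for the pivot and 0 for shifted vectors, so the pivot enters with coefficient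
0. The same coordinate makes the sum in `finrank_pivot_sup` direct. -/
theorem mem_pivot_sup_iff (q : List Bool × Bool) (S : Submodule (ZMod 2) (ℕ → ZMod 2))
    (v : ℕ → ZMod 2) :
    shift v ∈ Submodule.span (ZMod 2) {pivotVec q} ⊔ S.map shift ↔ v ∈ S := by
  constructor
  · intro h
    obtain ⟨a, ha, b, ⟨u, hu, rfl⟩, hab⟩ := Submodule.mem_sup.1 h
    obtain ⟨c, rfl⟩ := Submodule.mem_span_singleton.1 ha
    have h0 := congrFun hab 0
    simp [pivotVec] at h0
    rw [h0, zero_smul, zero_add] at hab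
    rwa [← shift_injective hab]
  · intro h
    exact Submodule.mem_sup_right (Submodule.mem_map_of_mem h)

theorem finrank_pivot_sup (q : List Bool × Bool) (S : Submodule (ZMod 2) (ℕ → ZMod 2))
    [FiniteDimensional (ZMod 2) S] :
    Module.finrank (ZMod 2) ↥(Submodule.span (ZMod 2) {pivotVec q} ⊔ S.map shift) =
      Module.finrank (ZMod 2) S + 1 := by
  have hinf : Submodule.span (ZMod 2) {pivotVec q} ⊓ S.map shift = ⊥ := by
    rw [eq_bot_iff]
    rintro v ⟨hv, u, hu, rfl⟩
    obtain ⟨c, hc⟩ := Submodule.mem_span_singleton.1 hv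
    have h0 := congrFun hc 0
    simp [pivotVec] at h0
    simp [← hc, h0]
  have hq : pivotVec q ≠ 0 := by
    intro h
    have h0 := congrFun h 0
    simp [pivotVec] at h0
  have := Submodule.finrank_sup_add_finrank_inf_eq (Submodule.span (ZMod 2) {pivotVec q})
    (S.map shift)
  rw [hinf, finrank_bot, finrank_span_singleton hq,
    finrank_map_shift] at this
  omega

/-- Induction on the columns. A pivot among the unmarked rows lowers the rank by one and leaves
unchanged whether the marked row lies in their span. As the marked row comes last, it is chosen only
if every unmarked row has a 0 in the column where it has a 1, and then it is outside the span. -/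
theorem elim_spec (n : ℕ) (rows : List (List Bool × Bool)) (c : List Bool) (acc : List Bool)
    (h : IsWidth n rows) (hm : ∀ r ∈ rows, r.2 = false) (hc : c.length = n) :
    (bitVec c ∈ rowSpan rows → elim n (rows ++ [(c, true)]) acc =
      List.replicate (Module.finrank (ZMod 2) (rowSpan rows)) false ++ acc) ∧
    (bitVec c ∉ rowSpan rows → true ∈ elim n (rows ++ [(c, true)]) acc) := by
  induction n generalizing rows c acc with
  | zero =>
    obtain rfl := List.length_eq_zero_iff.1 hc
    -- With no columns left both the span and the marked row are zero, so the second claim is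
    -- vacuous.
    have hbot : rowSpan rows = ⊥ := by
      rw [rowSpan, Submodule.span_eq_bot]
      rintro v ⟨r, hr, rfl⟩
      rw [List.length_eq_zero_iff.1 (h r hr), bitVec_nil]
    rw [hbot]
    simp [elim]
  | succ n ih =>
    obtain ⟨h1, -, h3⟩ := elimStep_width rows none h (by simp)
    obtain ⟨h4, h5⟩ := elimStep_mark rows none hm (by simp)
    have h6 := elimStep_none rows h
    obtain _ | ⟨b, c⟩ := c
    · simp at hc
    have hc' : c.length = n := by simpa using hc
    rw [elim, elimStep_append]
    cases hq : (elimStep none rows).1 with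
    | none =>
      rw [hq, Option.elim_none, bot_sup_eq] at h6
      cases b with
      | false =>
        have h7 : bitVec (false :: c) = shift (bitVec c) := by simp [bitVec_cons]
        rw [h6, h7, finrank_map_shift]
        have h8 : shift (bitVec c) ∈ (rowSpan (elimStep none rows).2).map shift ↔
            bitVec c ∈ rowSpan (elimStep none rows).2 := shift_injective.mem_set_image
        rw [h8]
        simpa [elimStep] using ih (elimStep none rows).2 c acc h1 h4 hc'
      | true =>
        constructor
        · intro hmem
          -- Every unmarked row starts with 0, so a vector starting with 1 is outside their span.
          rw [h6] at hmem
          obtain ⟨u, -, hu⟩ := hmem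
          have h0 := congrFun hu 0
          simp [bitVec] at h0
        · intro _
          exact mem_elim_of_mem _ _ _ (by simp [elimStep])
    | some q =>
      have hq1 : q.1.length = n := h3 q hq
      have hq2 : q.2 = false := h5 q hq
      rw [hq, Option.elim_some] at h6
      cases b with
      | false =>
        have h7 : bitVec (false :: c) = shift (bitVec c) := by simp [bitVec_cons]
        rw [h6, h7, mem_pivot_sup_iff, finrank_pivot_sup]
        simpa [elimStep, hq2, List.replicate_succ'] using
          ih (elimStep none rows).2 c (false :: acc) h1 h4 hc'
      | true =>
        rw [h6, shift_bitVec_xor c q (hc'.trans hq1.symm), Submodule.add_mem_iff_right _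
          (Submodule.mem_sup_left (Submodule.mem_span_singleton_self _)),
          mem_pivot_sup_iff, finrank_pivot_sup]
        simpa [elimStep, hq2, List.replicate_succ'] using
          ih (elimStep none rows).2 (List.zipWith xor c q.1) (false :: acc) h1 h4
            (by simp [hc', hq1])

/-! ### Irreducible affine relations -/

theorem sum_bz_eq {n : ℕ} (t : Fin n → Bool) :
    ∑ i, bz (t i) = ((Finset.univ.filter fun i => t i = true).card : ZMod 2) := by
  simp [bz]

theorem Clause.exists_linear_of_xor {V : Type} (C : Clause xorRels V) :
    ∃ c : ZMod 2, ∀ α : V → Bool, C.Sat α ↔ ∑ i, bz (α (C.args i)) = c := by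
  obtain ⟨⟨R, hR⟩, args⟩ := C
  rcases hR with ⟨n, rfl⟩ | ⟨n, rfl⟩
  · exact ⟨1, fun α => ((ZMod.natCast_eq_one_iff_odd).symm.trans
      (by rw [← sum_bz_eq]; rfl) : Odd _ ↔ _)⟩
  · exact ⟨0, fun α => ((not_congr ZMod.natCast_eq_one_iff_odd).symm.trans (by
      rw [← sum_bz_eq]
      change _ ↔ ∑ i : Fin n, bz (α (args i)) = 0
      generalize ∑ i : Fin n, bz (α (args i)) = a
      revert a
      decide) : ¬ Odd _ ↔ _)⟩

/-- A relation is affine iff it is the set of solutions of a system of linear equations. -/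
theorem BoolRel.Affine.exists_system {R : BoolRel} (h : R.Affine) :
    ∃ S : List ((Fin R.arity → ZMod 2) × ZMod 2),
      ∀ t, t ∈ R.tuples ↔ ∀ e ∈ S, ∑ i, e.1 i * bz (t i) = e.2 := by
  obtain ⟨φ, hφ⟩ := h
  choose c hc using fun C : Clause xorRels (Fin R.arity) => C.exists_linear_of_xor
  refine ⟨φ.map fun C => (fun i => ∑ j, if C.args j = i then 1 else 0, c C), fun t => ?_⟩
  rw [← hφ t, Sat, List.forall_mem_map]
  refine forall₂_congr fun C _ => ?_
  rw [hc]
  have : ∑ i, (∑ j, if C.args j = i then (1 : ZMod 2) else 0) * bz (t i) =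
      ∑ j, bz (t (C.args j)) := by
    simp_rw [Finset.sum_mul]
    rw [Finset.sum_comm]
    simp
  rw [this]

/-- A relation given by linear equations none of which contains all variables is reducible. -/
theorem BoolRel.not_irreducible_of_system {R : BoolRel} (hR : 2 ≤ R.arity)
    (S : List ((Fin R.arity → ZMod 2) × ZMod 2))
    (hS : ∀ t, t ∈ R.tuples ↔ ∀ e ∈ S, ∑ i, e.1 i * bz (t i) = e.2)
    (hz : ∀ e ∈ S, ∃ i, e.1 i = 0) : ¬ R.Irreducible := by
  intro h
  obtain ⟨n, tuples⟩ := R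
  obtain ⟨m, rfl⟩ : ∃ m, n = m + 1 + 1 := ⟨n - 2, by simp only at hR; omega⟩
  choose! z hz using hz
  let f : (Fin (m + 1 + 1) → ZMod 2) × ZMod 2 → Clause Set.univ (Fin (m + 1 + 1)) := fun e =>
    ⟨⟨⟨m + 1, {u | ∑ j, e.1 ((z e).succAbove j) * bz (u j) = e.2}⟩, trivial⟩, (z e).succAbove⟩
  -- A trivial clause, since irreducibility speaks only of non-empty formulas and `S` may be empty.
  let C₀ : Clause Set.univ (Fin (m + 1 + 1)) := ⟨⟨⟨m + 1, Set.univ⟩, trivial⟩, Fin.castSucc⟩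
  have har : ∀ C ∈ C₀ :: S.map f, C.rel.1.arity = m + 1 := by
    rw [List.forall_mem_cons, List.forall_mem_map]
    exact ⟨rfl, fun _ _ => rfl⟩
  obtain ⟨C, hC, hle⟩ := h (C₀ :: S.map f) (by simp) (fun C hC => by rw [har C hC]; omega) (by
    intro t
    rw [hS t, Sat, List.forall_mem_cons, List.forall_mem_map]
    have h0 : C₀.Sat t := trivial
    simp only [h0, true_and]
    refine forall₂_congr fun e he => ?_
    rw [Fin.sum_univ_succAbove _ (z e), hz e he, zero_mul, zero_add]
    rfl)
  have := har C hC
  simp only at hle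
  omega

/-- A non-empty irreducible affine relation is given by the empty equation or by a single equation
in all variables. -/
theorem BoolRel.exists_equation {R : BoolRel} (hne : R.tuples.Nonempty) (haff : R.Affine)
    (hirr : R.Irreducible) :
    ∃ p : Bool × Bool, ∀ t, t ∈ R.tuples ↔ bz p.1 * ∑ i, bz (t i) = bz p.2 := by
  have hsurj (a : ZMod 2) : ∃ b, bz b = a := by revert a; decide
  have h01 (a : ZMod 2) : a = 0 ∨ a = 1 := by revert a; decide
  obtain ⟨S, hS⟩ := haff.exists_system
  obtain ⟨t₀, ht₀⟩ := hne
  have ht₀' := (hS t₀).1 ht₀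
  by_cases hconst : ∀ e ∈ S, e.1 = 0 ∨ e.1 = 1
  · by_cases hone : ∃ e ∈ S, e.1 = 1
    · obtain ⟨e, he, he1⟩ := hone
      obtain ⟨c, hc⟩ := hsurj e.2
      refine ⟨(true, c), fun t => ?_⟩
      have het := ht₀' e he
      simp only [he1, Pi.one_apply, one_mul] at het
      rw [hS, bz_true, one_mul, hc]
      -- The tuple `t₀` satisfies all equations at once, so those in all variables share their
      -- constant and those in no variable are trivial.
      refine ⟨fun h => by simpa [he1] using h e he, fun h e' he' => ?_⟩
      have het' := ht₀' e' he'
      rcases hconst e' he' with h' | h'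
      · simpa [h'] using het'
      · simp only [h', Pi.one_apply, one_mul] at het' ⊢
        rw [h, ← het, het']
    · refine ⟨(false, false), fun t => ?_⟩
      simp only [bz_false, zero_mul, iff_true]
      rw [hS]
      intro e he
      have h' : e.1 = 0 := (hconst e he).resolve_right fun h => hone ⟨e, he, h⟩
      simpa [h'] using ht₀' e he
  · push Not at hconst
    obtain ⟨e₀, he₀, h0, h1⟩ := hconst
    obtain ⟨i, hi⟩ := Function.ne_iff.1 h0
    obtain ⟨j, hj⟩ := Function.ne_iff.1 h1
    replace hi : e₀.1 i = 1 := (h01 _).resolve_left hi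
    replace hj : e₀.1 j = 0 := (h01 _).resolve_right hj
    have hij : i ≠ j := fun h => by simp [h, hj] at hi
    have har : 2 ≤ R.arity := by
      have := i.2; have := j.2
      by_contra h
      exact hij (Fin.ext (by omega))
    -- `e₀` contains variable `i` but not `j`. Adding it to an equation in all variables removes
    -- `i`; `e₀` itself is not such an equation and stays, so the change can be undone.
    refine absurd hirr (BoolRel.not_irreducible_of_system har
      (S.map fun e => if e.1 = 1 then e + e₀ else e) (fun t => ?_) ?_)
    · rw [hS, List.forall_mem_map]
      have key (e : (Fin R.arity → ZMod 2) × ZMod 2) : ∑ i, (e + e₀).1 i * bz (t i) =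
          ∑ i, e.1 i * bz (t i) + ∑ i, e₀.1 i * bz (t i) := by
        simp [add_mul, Finset.sum_add_distrib]
      constructor
      · intro h e he
        split
        · rw [key, h e he, h e₀ he₀]; rfl
        · exact h e he
      · intro h e he
        have h2 := h e₀ he₀
        rw [if_neg h1] at h2
        have h3 := h e he
        split at h3
        · rw [key, h2] at h3
          exact add_right_cancel h3
        · exact h3
    · rw [List.forall_mem_map]
      intro e he
      split
      next h => exact ⟨i, by simp [h, hi]; decide⟩
      next h =>
        obtain ⟨l, hl⟩ := Function.ne_iff.1 h
        exact ⟨l, (h01 _).resolve_right hl⟩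

/-! ### Formulas as systems of linear equations -/

/-- `eqs R` is the pair of the common coefficient and the constant of an equation for `R`. -/
def IsEquations {Γ : Set BoolRel} (eqs : Γ → Bool × Bool) : Prop :=
  ∀ (R : Γ) (t : Fin R.1.arity → Bool),
    t ∈ R.1.tuples ↔ bz (eqs R).1 * ∑ i, bz (t i) = bz (eqs R).2

theorem exists_equations {Γ : Set BoolRel} (hΓ : IsConstraintLanguage Γ)
    (hirr : IrreducibleLanguage Γ) (haff : AffineLanguage Γ) :
    ∃ eqs : Γ → Bool × Bool, IsEquations eqs := by
  choose eqs h using fun R : Γ =>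
    BoolRel.exists_equation (hΓ.2 R.1 R.2) (haff R.1 R.2) (hirr R.1 R.2)
  exact ⟨eqs, h⟩

theorem bz_injective : Injective bz := by
  intro a b h
  revert h
  cases a <;> cases b <;> decide

theorem bz_decide (a : ZMod 2) : bz (decide (a = 1)) = a := by
  revert a; decide

variable {Γ : Set BoolRel} {V : Type} (eqs : Γ → Bool × Bool)

/-- The linear form of a clause. -/
def Clause.form (C : Clause Γ V) : (V → ZMod 2) →ₗ[ZMod 2] ZMod 2 :=
  bz (eqs C.rel).1 • ∑ i, LinearMap.proj (C.args i)

theorem Clause.form_apply (C : Clause Γ V) (α : V → ZMod 2) :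
    C.form eqs α = bz (eqs C.rel).1 * ∑ i, α (C.args i) := by
  simp [Clause.form]

/-- The linear map of a formula. -/
def formMap (φ : Formula Γ V) : (V → ZMod 2) →ₗ[ZMod 2] (ℕ → ZMod 2) :=
  LinearMap.pi fun i => φ[i]?.elim 0 (Clause.form eqs)

/-- The linear map of a formula, with values in a space of minimal dimension. -/
def finMap (φ : Formula Γ V) : (V → ZMod 2) →ₗ[ZMod 2] (Fin φ.length → ZMod 2) :=
  LinearMap.pi fun i => (φ[i]).form eqs

/-- Values in `ℕ → ZMod 2` match the rows of the matrix, while the finite codomain of `finMap` makes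
surjectivity meaningful. The common kernel lets ranks pass from one to the other. -/
theorem ker_formMap (φ : Formula Γ V) :
    LinearMap.ker (formMap eqs φ) = LinearMap.ker (finMap eqs φ) := by
  ext α
  simp only [LinearMap.mem_ker, funext_iff, formMap, finMap, LinearMap.pi_apply, Pi.zero_apply]
  constructor
  · intro h i
    simpa using h i
  · intro h i
    by_cases hi : i < φ.length
    · simpa [hi] using h ⟨i, hi⟩
    · simp [List.getElem?_eq_none (not_lt.1 hi)]

/-- Both ranges are the quotient of `E` by the common kernel. No dimension of `E` is used, as there
may be infinitely many variables. -/
theorem finrank_range_eq_of_ker_eq {E A B : Type*} [AddCommGroup E] [Module (ZMod 2) E]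
    [AddCommGroup A] [Module (ZMod 2) A] [AddCommGroup B] [Module (ZMod 2) B]
    {f : E →ₗ[ZMod 2] A} {g : E →ₗ[ZMod 2] B} (h : LinearMap.ker f = LinearMap.ker g) :
    Module.finrank (ZMod 2) (LinearMap.range f) = Module.finrank (ZMod 2) (LinearMap.range g) :=
  (f.quotKerEquivRange.symm.trans
    ((Submodule.quotEquivOfEq _ _ h).trans g.quotKerEquivRange)).finrank_eq

variable {eqs}

theorem Clause.sat_iff (heqs : IsEquations eqs) (C : Clause Γ V) (β : V → Bool) :
    C.Sat β ↔ C.form eqs (fun v => bz (β v)) = bz (eqs C.rel).2 := by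
  rw [Clause.form_apply]
  exact heqs C.rel _

theorem sat_iff_finMap (heqs : IsEquations eqs) (φ : Formula Γ V) (β : V → Bool) :
    Sat φ β ↔ finMap eqs φ (fun v => bz (β v)) = fun i => bz (eqs (φ[i]).rel).2 := by
  rw [Sat, List.forall_mem_iff_getElem, funext_iff, Fin.forall_iff]
  exact forall₂_congr fun i hi => (φ[i]).sat_iff heqs β

theorem sat_iff_formMap (heqs : IsEquations eqs) (φ : Formula Γ V) (β : V → Bool) :
    Sat φ β ↔ formMap eqs φ (fun v => bz (β v)) = bitVec (φ.map fun C => (eqs C.rel).2) := by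
  rw [Sat, List.forall_mem_iff_getElem, funext_iff]
  constructor
  · intro h i
    by_cases hi : i < φ.length
    · simpa [formMap, bitVec, hi] using ((φ[i]).sat_iff heqs β).1 (h i hi)
    · simp [formMap, bitVec, List.getElem?_eq_none (not_lt.1 hi)]
  · intro h i hi
    rw [Clause.sat_iff heqs]
    simpa [formMap, bitVec, hi] using h i

theorem sat_iff_sub_mem_ker (heqs : IsEquations eqs) {φ : Formula Γ V} {β : V → Bool} (hβ : Sat φ β)
    (α : V → Bool) :
    Sat φ α ↔ (fun v => bz (α v)) - (fun v => bz (β v)) ∈ LinearMap.ker (finMap eqs φ) := by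
  rw [sat_iff_finMap heqs, LinearMap.mem_ker, map_sub, (sat_iff_finMap heqs φ β).1 hβ, sub_eq_zero]

theorem ker_le_of_equivalent (heqs : IsEquations eqs) {φ ψ : Formula Γ V} (h : Equivalent φ ψ)
    (hφ : Satisfiable φ) :
    LinearMap.ker (finMap eqs φ) ≤ LinearMap.ker (finMap eqs ψ) := by
  obtain ⟨β, hβ⟩ := hφ
  intro u hu
  -- The Boolean assignment corresponding to the vector `u` plus the solution `β`.
  have hα : (fun v => bz (decide (u v + bz (β v) = 1))) - (fun v => bz (β v)) = u := by
    funext v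
    simp [bz_decide]
  have h1 := (sat_iff_sub_mem_ker heqs hβ fun v => decide (u v + bz (β v) = 1)).2 (by rwa [hα])
  have h2 := (sat_iff_sub_mem_ker heqs ((h β).1 hβ) _).1 ((h _).1 h1)
  rwa [hα] at h2

theorem ker_eq_of_equivalent (heqs : IsEquations eqs) {φ ψ : Formula Γ V} (h : Equivalent φ ψ)
    (hφ : Satisfiable φ) :
    LinearMap.ker (finMap eqs φ) = LinearMap.ker (finMap eqs ψ) :=
  le_antisymm (ker_le_of_equivalent heqs h hφ)
    (ker_le_of_equivalent heqs (fun α => (h α).symm) (hφ.imp fun α hα => (h α).1 hα))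

/-- Irredundance yields, for each `i`, an assignment violating clause `i` alone. Over two elements a
violated equation is off by exactly 1, so its difference from a solution is mapped to the `i`-th
unit vector. -/
theorem range_finMap_eq_top (heqs : IsEquations eqs) {φ : Formula Γ V} (hφ : Satisfiable φ)
    (hirr : Irredundant φ) :
    LinearMap.range (finMap eqs φ) = ⊤ := by
  obtain ⟨β, hβ⟩ := hφ
  have hsingle (i : Fin φ.length) : Pi.single i 1 ∈ LinearMap.range (finMap eqs φ) := by
    have h := hirr i i.2
    simp only [Equivalent, not_forall] at h
    obtain ⟨α, hα⟩ := h
    have himp : Sat φ α → Sat (φ.eraseIdx i) α := fun h C hC => h C (List.mem_of_mem_eraseIdx hC)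
    obtain ⟨h1, h2⟩ : Sat (φ.eraseIdx i) α ∧ ¬ Sat φ α := by tauto
    have h3 (j : Fin φ.length) (hj : j ≠ i) : (φ[j]).Sat α :=
      h1 _ (List.mem_eraseIdx_iff_getElem.2 ⟨j, j.2, fun h => hj (Fin.ext h), rfl⟩)
    have h4 : ¬ (φ[i]).Sat α := by
      intro h4
      refine h2 (List.forall_mem_iff_getElem.2 fun j hj => ?_)
      by_cases hji : (⟨j, hj⟩ : Fin φ.length) = i
      · subst hji; exact h4
      · exact h3 ⟨j, hj⟩ hji
    refine ⟨(fun v => bz (α v)) - (fun v => bz (β v)), funext fun j => ?_⟩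
    have hβj : (φ[j]).Sat β := hβ _ (List.getElem_mem _)
    rw [Clause.sat_iff heqs] at hβj
    have happ : finMap eqs φ ((fun v => bz (α v)) - (fun v => bz (β v))) j =
        (φ[j]).form eqs (fun v => bz (α v)) - bz (eqs (φ[j]).rel).2 := by
      rw [map_sub, Pi.sub_apply, ← hβj]; rfl
    rw [happ]
    by_cases hj : j = i
    · subst hj
      rw [Clause.sat_iff heqs] at h4
      rw [Pi.single_eq_same]
      exact (by decide : ∀ a : ZMod 2, a ≠ 0 → a = 1) _ (sub_ne_zero.2 h4)
    · rw [Pi.single_eq_of_ne hj, (Clause.sat_iff heqs _ _).1 (h3 j hj), sub_self]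
  rw [eq_top_iff]
  intro v _
  rw [← Finset.univ_sum_single v]
  refine sum_mem fun i _ => ?_
  rw [← mul_one (v i), ← smul_eq_mul, Pi.single_smul]
  exact Submodule.smul_mem _ _ (hsingle i)

theorem finrank_range_of_irredundant (heqs : IsEquations eqs) {φ : Formula Γ V} (hφ : Satisfiable φ)
    (hirr : Irredundant φ) :
    Module.finrank (ZMod 2) (LinearMap.range (finMap eqs φ)) = φ.length := by
  rw [range_finMap_eq_top heqs hφ hirr, finrank_top, Module.finrank_fin_fun]

theorem length_eq_of_equivalent (heqs : IsEquations eqs) {φ ψ : Formula Γ V} (hφ : Satisfiable φ)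
    (hφi : Irredundant φ)
    (hψi : Irredundant ψ) (h : Equivalent φ ψ) : φ.length = ψ.length := by
  rw [← finrank_range_of_irredundant heqs hφ hφi, ← finrank_range_of_irredundant heqs
    (hφ.imp fun α hα => (h α).1 hα) hψi]
  exact finrank_range_eq_of_ker_eq (ker_eq_of_equivalent heqs h hφ)

theorem card_solutions (heqs : IsEquations eqs) [Fintype V] {φ : Formula Γ V} (hφ : Satisfiable φ)
    (hirr : Irredundant φ) :
    φ.length ≤ Fintype.card V ∧
      Nat.card {α : V → Bool // Sat φ α} = 2 ^ (Fintype.card V - φ.length) := by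
  have h1 := LinearMap.finrank_range_add_finrank_ker (finMap eqs φ)
  rw [finrank_range_of_irredundant heqs hφ hirr, Module.finrank_fintype_fun_eq_card] at h1
  refine ⟨by omega, ?_⟩
  obtain ⟨β, hβ⟩ := hφ
  let e : {α : V → Bool // Sat φ α} ≃ LinearMap.ker (finMap eqs φ) :=
    { toFun := fun α => ⟨_, (sat_iff_sub_mem_ker heqs hβ α.1).1 α.2⟩
      invFun := fun u => ⟨fun v => decide (u.1 v + bz (β v) = 1), by
        rw [sat_iff_sub_mem_ker heqs hβ]
        convert u.2 using 1
        funext v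
        simp [bz_decide]⟩
      left_inv := fun α => by
        ext v
        simp [bz_decide, ← bz_injective.eq_iff]
      right_inv := fun u => by
        ext v
        simp [bz_decide] }
  rw [Nat.card_congr e, Module.natCard_eq_pow_finrank (K := ZMod 2), Nat.card_zmod]
  congr 1
  omega

theorem exists_irredundant (φ : Formula Γ V) :
    ∃ ψ : Formula Γ V, Irredundant ψ ∧ Equivalent ψ φ := by
  induction hn : φ.length using Nat.strong_induction_on generalizing φ with
  | _ n ih =>
    by_cases h : Irredundant φ
    · exact ⟨φ, h, fun _ => Iff.rfl⟩
    · simp only [Irredundant, not_forall, not_not] at h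
      obtain ⟨i, hi, h⟩ := h
      obtain ⟨ψ, h1, h2⟩ := ih _ (by rw [← hn, List.length_eraseIdx_of_lt hi]; omega)
        (φ.eraseIdx i) rfl
      exact ⟨ψ, h1, fun α => (h2 α).trans (h α)⟩

/-- The least length of a formula equivalent to a satisfiable formula is its rank. -/
theorem exists_short_iff_of_sat (heqs : IsEquations eqs) {φ : Formula Γ V} (hφ : Satisfiable φ)
    (k : ℕ) :
    (∃ ψ : Formula Γ V, ψ.length ≤ k ∧ Equivalent ψ φ) ↔
      Module.finrank (ZMod 2) (LinearMap.range (formMap eqs φ)) ≤ k := by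
  rw [finrank_range_eq_of_ker_eq (ker_formMap eqs φ)]
  have hsat {ψ : Formula Γ V} (h : Equivalent ψ φ) : Satisfiable ψ :=
    hφ.imp fun α hα => (h α).2 hα
  have hrank {ψ : Formula Γ V} (h : Equivalent ψ φ) :=
    finrank_range_eq_of_ker_eq (ker_eq_of_equivalent heqs h (hsat h))
  constructor
  · rintro ⟨ψ, hk, h⟩
    rw [← hrank h]
    -- The rank of a system is at most the number of its equations.
    exact ((Submodule.finrank_le _).trans_eq (Module.finrank_fin_fun _)).trans hk
  · intro hk
    obtain ⟨ψ, hirr, h⟩ := exists_irredundant φ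
    refine ⟨ψ, ?_, h⟩
    rwa [← finrank_range_of_irredundant heqs (hsat h) hirr, hrank h]

/-! ### The system computed from a formula, and its rank. -/

open Computability (encodeNat)

variable {Γ : Set BoolRel} {eqs : Γ → Bool × Bool}

/-- The system of equations of a formula. -/
def sysOf (eqs : Γ → Bool × Bool) (φ : Formula Γ ℕ) : List (Bool × List (List Bool)) :=
  φ.map fun C => ((eqs C.rel).2,
    if (eqs C.rel).1 then List.ofFn fun i => encodeNat (C.args i) else [])

theorem encodeNat_injective : Injective encodeNat :=
  LeftInverse.injective Computability.decode_encodeNat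

theorem bz_parityFrom (x : List Bool) (b : Bool) (ys : List (List Bool)) :
    bz (parityFrom x b ys) = bz b + (ys.map fun y => bz (decide (y = x))).sum := by
  induction ys generalizing b with
  | nil => simp [parityFrom]
  | cons y ys ih =>
    rw [parityFrom, List.foldl_cons, ← parityFrom, ih, bz_xor, List.map_cons, List.sum_cons,
      add_assoc]

theorem bitVec_map_apply {ι : Type*} (f : ι → Bool) (l : List ι) (i : ℕ) :
    bitVec (l.map f) i = l[i]?.elim 0 fun C => bz (f C) := by
  rw [bitVec, List.getD_eq_getElem?_getD, List.getElem?_map]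
  cases l[i]? <;> rfl

theorem formMap_apply {V : Type} (φ : Formula Γ V) (α : V → ZMod 2) (i : ℕ) :
    formMap eqs φ α i = φ[i]?.elim 0 fun C => C.form eqs α := by
  rw [formMap, LinearMap.pi_apply]
  cases φ[i]? <;> rfl

/-- Repeated variables cancel in pairs on both sides: `coeffs` counts occurrences modulo 2, as the
linear form does. -/
theorem bitVec_coeffs (φ : Formula Γ ℕ) (x : ℕ) :
    bitVec (coeffs (encodeNat x) (sysOf eqs φ)) = formMap eqs φ (Pi.single x 1) := by
  funext i
  rw [coeffs, sysOf, List.map_map, bitVec_map_apply, formMap_apply]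
  cases φ[i]? with
  | none => rfl
  | some C =>
    simp only [Option.elim_some, comp_apply, bz_parityFrom, Clause.form_apply]
    cases (eqs C.rel).1 with
    | false => simp
    | true =>
      simp only [if_true, List.map_ofFn, List.sum_ofFn, bz_false, zero_add, bz_true, one_mul,
        comp_apply, Pi.single_apply, encodeNat_injective.eq_iff]
      exact Finset.sum_congr rfl fun j _ => by by_cases h : C.args j = x <;> simp [h]

/-- The rows are the images of the unit vectors of the variables that occur. They are listed with
the equations reversed, hence `φ.reverse`. -/
theorem rowSpan_sysOf (φ : Formula Γ ℕ) :
    rowSpan (((sysOf eqs φ).flatMap Prod.snd).map (rowOf (sysOf eqs φ))).reverse =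
      LinearMap.range (formMap eqs φ.reverse) := by
  have hrow (x : ℕ) : bitVec (rowOf (sysOf eqs φ) (encodeNat x)).1 =
      formMap eqs φ.reverse (Pi.single x 1) := by
    rw [← bitVec_coeffs, rowOf, coeffs, coeffs, sysOf, sysOf, List.map_reverse, List.map_reverse]
  have hname (y : List Bool) : y ∈ (sysOf eqs φ).flatMap Prod.snd ↔
      ∃ C ∈ φ, (eqs C.rel).1 = true ∧ ∃ j, encodeNat (C.args j) = y := by
    simp only [sysOf, List.mem_flatMap, List.mem_map, exists_exists_and_eq_and]
    refine exists_congr fun C => and_congr_right fun _ => ?_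
    cases (eqs C.rel).1 <;> simp [List.mem_ofFn]
  apply le_antisymm
  · rw [rowSpan, Submodule.span_le]
    rintro v ⟨r, hr, rfl⟩
    obtain ⟨y, hy, rfl⟩ := List.mem_map.1 (List.mem_reverse.1 hr)
    obtain ⟨C, -, -, j, rfl⟩ := (hname y).1 hy
    rw [hrow]
    exact LinearMap.mem_range_self _ _
  · rintro v ⟨α, rfl⟩
    -- Unit vectors do not span `ℕ → ZMod 2`, but the map depends only on the finitely many
    -- variables in `X`, so `α` may be cut off outside `X`.
    let X : Finset ℕ :=
      (φ.flatMap fun C => if (eqs C.rel).1 then List.ofFn C.args else []).toFinset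
    have hα : formMap eqs φ.reverse α =
        formMap eqs φ.reverse (∑ x ∈ X, α x • Pi.single x (1 : ZMod 2)) := by
      funext i
      rw [formMap_apply, formMap_apply]
      cases hC : φ.reverse[i]? with
      | none => rfl
      | some C =>
        have hmem : C ∈ φ := List.mem_reverse.1 (List.mem_of_getElem? hC)
        simp only [Option.elim_some, Clause.form_apply]
        cases ha : (eqs C.rel).1 with
        | false => simp
        | true =>
          refine congrArg _ (Finset.sum_congr rfl fun j _ => ?_)
          have hj : C.args j ∈ X := by
            simp only [X, List.mem_toFinset, List.mem_flatMap]
            exact ⟨C, hmem, by simp [ha, List.mem_ofFn]⟩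
          simp [Finset.sum_apply, Pi.single_apply, hj]
    rw [hα, map_sum]
    refine sum_mem fun x hx => ?_
    rw [map_smul]
    refine Submodule.smul_mem _ _ (Submodule.subset_span ?_)
    simp only [X, List.mem_toFinset, List.mem_flatMap] at hx
    obtain ⟨C, hC, hx⟩ := hx
    cases ha : (eqs C.rel).1 with
    | false => simp [ha] at hx
    | true =>
      simp only [ha, if_true, List.mem_ofFn] at hx
      obtain ⟨j, rfl⟩ := hx
      exact ⟨rowOf (sysOf eqs φ) (encodeNat (C.args j)), List.mem_reverse.2
        (List.mem_map_of_mem ((hname _).2 ⟨C, hC, ha, j, rfl⟩)), hrow _⟩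

theorem sat_reverse {V : Type} (φ : Formula Γ V) (α : V → Bool) : Sat φ.reverse α ↔ Sat φ α := by
  simp [Sat]

/-- The vector of constants lies in the range of the coefficient map iff the formula is satisfiable,
so `elim_spec` applies. -/
theorem outcome_sysOf (heqs : IsEquations eqs) (c : ℕ) (φ : Formula Γ ℕ) :
    (Satisfiable φ → outcome c (sysOf eqs φ) =
      Module.finrank (ZMod 2) (LinearMap.range (formMap eqs φ.reverse))) ∧
    (¬ Satisfiable φ → outcome c (sysOf eqs φ) = c) := by
  have hw := isWidth_matrixRows (sysOf eqs φ)
  have hspec := elim_spec (sysOf eqs φ).length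
    (((sysOf eqs φ).flatMap Prod.snd).map (rowOf (sysOf eqs φ))).reverse
    ((sysOf eqs φ).map Prod.fst).reverse [] (fun r hr => hw r (List.mem_append_left _ hr))
    (fun r hr => by
      obtain ⟨y, -, rfl⟩ := List.mem_map.1 (List.mem_reverse.1 hr)
      rfl) (by simp)
  have hc : ((sysOf eqs φ).map Prod.fst).reverse = φ.reverse.map fun C => (eqs C.rel).2 := by
    rw [sysOf, List.map_map, List.map_reverse]
    rfl
  have hsat : bitVec ((sysOf eqs φ).map Prod.fst).reverse ∈
      LinearMap.range (formMap eqs φ.reverse) ↔ Satisfiable φ := by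
    rw [hc]
    constructor
    · rintro ⟨α, hα⟩
      refine ⟨fun v => decide (α v = 1), ?_⟩
      rw [← sat_reverse, sat_iff_formMap heqs, ← hα]
      simp only [bz_decide]
    · rintro ⟨β, hβ⟩
      rw [← sat_reverse, sat_iff_formMap heqs] at hβ
      exact ⟨_, hβ⟩
  rw [rowSpan_sysOf, hsat] at hspec
  constructor
  · intro h
    rw [outcome, matrixRows, hspec.1 h]
    simp
  · intro h
    rw [outcome, matrixRows, if_pos (hspec.2 h)]

/-- The least length of an unsatisfiable formula. -/
noncomputable def minUnsat (Γ : Set BoolRel) : ℕ :=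
  sInf {n | ∃ ψ : Formula Γ ℕ, ¬ Satisfiable ψ ∧ ψ.length = n}

/-- All unsatisfiable formulas are equivalent, so `minUnsat Γ` answers for each of them. It depends
on `Γ` alone and is built into the machine. If no unsatisfiable formula exists, its value is
irrelevant. -/
theorem outcome_le_iff (heqs : IsEquations eqs) (φ : Formula Γ ℕ) (k : ℕ) :
    outcome (minUnsat Γ) (sysOf eqs φ) ≤ k ↔
      ∃ ψ : Formula Γ ℕ, ψ.length ≤ k ∧ Equivalent ψ φ := by
  by_cases hφ : Satisfiable φ
  · rw [(outcome_sysOf heqs _ φ).1 hφ, ← exists_short_iff_of_sat heqs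
      (hφ.imp fun α hα => (sat_reverse φ α).2 hα)]
    simp only [Equivalent, sat_reverse]
  · rw [(outcome_sysOf heqs _ φ).2 hφ]
    constructor
    · intro hk
      obtain ⟨ψ, hψ, hlen⟩ := Nat.sInf_mem
        (s := {n | ∃ ψ : Formula Γ ℕ, ¬ Satisfiable ψ ∧ ψ.length = n}) ⟨_, φ, hφ, rfl⟩
      exact ⟨ψ, hlen.trans_le hk, fun α =>
        ⟨fun h => absurd ⟨α, h⟩ hψ, fun h => absurd ⟨α, h⟩ hφ⟩⟩
    · rintro ⟨ψ, hlen, h⟩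
      refine le_trans (Nat.sInf_le ?_) hlen
      exact ⟨ψ, fun hψ => hφ (hψ.imp fun α hα => (h α).1 hα), rfl⟩

open Computability (encodeNat encodeNum encodePosNum decodePosNum)

/-! ### Parsing instances -/

/-- A binary code without leading zeros. -/
def IsCanonical (l : List Bool) : Prop := l.getLast? ≠ some false

theorem isCanonical_encodePosNum (p : PosNum) : (encodePosNum p).getLast? = some true := by
  induction p with
  | one => rfl
  | bit0 p ih => rw [encodePosNum, List.getLast?_cons, ih]; rfl
  | bit1 p ih => rw [encodePosNum, List.getLast?_cons, ih]; rfl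

theorem encodePosNum_decodePosNum (l : List Bool) (h : l.getLast? = some true) :
    encodePosNum (decodePosNum l) = l := by
  induction l with
  | nil => cases h
  | cons b l ih =>
    rw [List.getLast?_cons] at h
    cases l with
    | nil =>
      simp at h
      subst h
      rfl
    | cons a l =>
      have h' : (a :: l).getLast? = some true := by
        rw [List.getLast?_cons] at h ⊢
        simpa using h
      have := ih h'
      cases b with
      | false => rw [decodePosNum, encodePosNum, this]
      | true => rw [decodePosNum, if_neg (by simp), encodePosNum, this]

/-- The most significant bit comes last, so a superfluous zero is a final `false`; zero has the
empty code. The parser needs this test to reject words that are not codes. -/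
theorem isCanonical_iff (l : List Bool) : IsCanonical l ↔ ∃ n, encodeNat n = l := by
  constructor
  · intro h
    by_cases hl : l = []
    · exact ⟨0, hl.symm⟩
    · have h' : l.getLast? = some true := by
        unfold IsCanonical at h
        rw [List.getLast?_eq_some_getLast hl] at h ⊢
        simpa using h
      refine ⟨((Num.pos (decodePosNum l) : Num) : ℕ), ?_⟩
      rw [encodeNat, Num.of_to_nat, encodeNum, encodePosNum_decodePosNum l h']
  · rintro ⟨n, rfl⟩
    rw [IsCanonical, encodeNat]
    cases (n : Num) with
    | zero => simp [encodeNum]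
    | pos p => rw [encodeNum, isCanonical_encodePosNum]; simp

theorem isCanonical_append (l : List Bool) (b : Bool) : IsCanonical (l ++ [b]) ↔ b = true := by
  simp [IsCanonical]

theorem binVal_encodePosNum (p : PosNum) : binVal (encodePosNum p) = (p : ℕ) := by
  induction p with
  | one => rfl
  | bit0 p ih => rw [encodePosNum, binVal_cons, ih]; simp [two_mul]
  | bit1 p ih => rw [encodePosNum, binVal_cons, ih]; simp [two_mul]; omega

theorem binVal_encodeNat (n : ℕ) : binVal (encodeNat n) = n := by
  conv_rhs => rw [← Num.to_of_nat n]
  rw [encodeNat]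
  cases (n : Num) with
  | zero => rfl
  | pos p => exact binVal_encodePosNum p

/-- The states of the parser: `fail`, between two clauses, inside the `j`-th argument of a clause,
and inside the bound. The flag tells whether the current code is canonical. -/
inductive PState (Γ : Set BoolRel) : Type
  | fail
  | start
  | arg (R : Γ) (j : Fin R.1.arity) (ok : Bool)
  | bound (ok : Bool)

theorem PState.finite {Γ : Set BoolRel} (hΓ : Γ.Finite) : Finite (PState Γ) := by
  have := hΓ.to_subtype
  let f : PState Γ → Option (Option ((Σ R : Γ, Fin R.1.arity × Bool) ⊕ Bool)) := fun
    | .fail => none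
    | .start => some none
    | .arg R j ok => some (some (Sum.inl ⟨R, j, ok⟩))
    | .bound ok => some (some (Sum.inr ok))
  refine Finite.of_injective f ?_
  rintro (_ | _ | ⟨R, j, ok⟩ | ok) (_ | _ | ⟨R', j', ok'⟩ | ok') h <;> simp [f] at h ⊢
  · obtain ⟨rfl, h⟩ := h
    simpa using h
  · exact h

theorem Letter.finite {Γ : Set BoolRel} (hΓ : Γ.Finite) : Finite (Letter Γ) := by
  have := hΓ.to_subtype
  let f : Letter Γ → Option (Option (Γ ⊕ Bool)) := fun
    | .rel R => some (some (Sum.inl R))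
    | .bit b => some (some (Sum.inr b))
    | .sep => some none
    | .minus => none
  refine Finite.of_injective f ?_
  rintro (_ | _ | _ | _) (_ | _ | _ | _) h <;> simp [f] at h ⊢ <;> exact h

variable {Γ : Set BoolRel}

/-- The state of the parser before the `j`-th argument of a clause. -/
def argState (R : Γ) (j : ℕ) : PState Γ :=
  if h : j < R.1.arity then .arg R ⟨j, h⟩ true else .start

/-- The transitions of the parser. -/
def pstep : PState Γ → Letter Γ → PState Γ
  | .start, .rel R => argState R 0
  | .start, .sep => .bound true
  | .arg R j _, .bit b => .arg R j b
  | .arg R j true, .sep => argState R (j + 1)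
  | .bound _, .bit b => .bound b
  | _, _ => .fail

/-- The output of the parser. -/
def pout (eqs : Γ → Bool × Bool) : PState Γ → Letter Γ → Option Tok
  | .start, .rel R => some (.eqn (eqs R).2)
  | .start, .sep => some (.mark true)
  | .arg R _ _, .bit b => if (eqs R).1 then some (.bit b) else none
  | .arg R _ _, .sep => if (eqs R).1 then some (.mark false) else none
  | .bound _, .bit b => some (.bit b)
  | _, _ => none

/-- The accepting state. -/
def paccept : PState Γ → Bool
  | .bound ok => ok
  | _ => false

/-- The words that lead to a state. -/
def Leads : PState Γ → List (Letter Γ) → Prop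
  | .fail, _ => True
  | .start, w => ∃ φ : Formula Γ ℕ, w = φ.flatMap codeClause
  | .arg R j ok, w => ∃ (φ : Formula Γ ℕ) (xs : List ℕ) (bits : List Bool), xs.length = j ∧
      w = φ.flatMap codeClause ++ .rel R :: xs.flatMap (fun x => codeNat Γ x ++ [Letter.sep]) ++
        bits.map .bit ∧ (ok = true ↔ IsCanonical bits)
  | .bound ok, w => ∃ (φ : Formula Γ ℕ) (bits : List Bool),
      w = φ.flatMap codeClause ++ .sep :: bits.map .bit ∧ (ok = true ↔ IsCanonical bits)

/-- Once all arguments are read, the pending symbol and its arguments form a further clause. This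
includes relations of arity 0, which have no argument state. -/
theorem leads_argState (φ : Formula Γ ℕ) (R : Γ) (xs : List ℕ) (h : xs.length ≤ R.1.arity) :
    Leads (argState R xs.length) (φ.flatMap codeClause ++
      .rel R :: xs.flatMap (fun x => codeNat Γ x ++ [Letter.sep])) := by
  rw [argState]
  split
  · exact ⟨φ, xs, [], rfl, by simp, by simp [IsCanonical]⟩
  · have hlen : xs.length = R.1.arity := by omega
    refine ⟨φ ++ [⟨R, fun i => xs[(i : ℕ)]⟩], ?_⟩
    have : List.ofFn (fun i : Fin R.1.arity => xs[(i : ℕ)]) = xs := by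
      apply List.ext_getElem <;> simp [hlen]
    simp [codeClause, this]

theorem leads_pstep (q : PState Γ) (a : Letter Γ) (w : List (Letter Γ)) (h : Leads q w) :
    Leads (pstep q a) (w ++ [a]) := by
  rcases q with _ | _ | ⟨R, j, ok⟩ | ok
  · cases a <;> trivial
  · obtain ⟨φ, rfl⟩ := h
    cases a with
    | rel R => exact leads_argState φ R [] (by simp)
    | sep => exact ⟨φ, [], by simp, by simp [IsCanonical]⟩
    | _ => trivial
  · obtain ⟨φ, xs, bits, hlen, rfl, hok⟩ := h
    cases a with
    | bit b => exact ⟨φ, xs, bits ++ [b], hlen, by simp, (isCanonical_append bits b).symm⟩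
    | sep =>
      cases ok with
      | false => trivial
      | true =>
        obtain ⟨x, hx⟩ := (isCanonical_iff bits).1 (hok.1 rfl)
        have := leads_argState φ R (xs ++ [x]) (by simp [hlen])
        simpa [pstep, codeNat, hx, hlen] using this
    | _ => cases ok <;> trivial
  · obtain ⟨φ, bits, rfl, hok⟩ := h
    cases a with
    | bit b => exact ⟨φ, bits ++ [b], by simp, (isCanonical_append bits b).symm⟩
    | _ => trivial

theorem leads_foldl (w : List (Letter Γ)) : Leads (w.foldl pstep .start) w := by
  induction w using List.reverseRecOn with
  | nil => exact ⟨[], rfl⟩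
  | append_singleton w a ih =>
    rw [List.foldl_append]
    exact leads_pstep _ a w ih

theorem exists_instance_of_accept (w : List (Letter Γ))
    (h : paccept (w.foldl pstep .start) = true) :
    ∃ (φ : Formula Γ ℕ) (k : ℕ), w = codeInstance φ k := by
  have hl := leads_foldl w
  revert h hl
  cases w.foldl pstep .start with
  | bound ok =>
    rintro rfl ⟨φ, bits, rfl, hok⟩
    obtain ⟨k, rfl⟩ := (isCanonical_iff bits).1 (hok.1 rfl)
    exact ⟨φ, k, by simp [codeInstance, codeInt, codeNat]⟩
  | _ => intro h; cases h

theorem emitted_append {L Q : Type} (δ : Q → L → Q) (em : Q → L → Option Tok) (q : Q)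
    (w w' : List L) : emitted δ em q (w ++ w') = emitted δ em q w ++ emitted δ em
        (w.foldl δ q) w' := by
  induction w generalizing q with
  | nil => rfl
  | cons a w ih => simp [emitted, ih]

variable (eqs : Γ → Bool × Bool)

theorem parse_bits_arg (R : Γ) (j : Fin R.1.arity) (ok : Bool) (l : List Bool) :
    (l.map Letter.bit).foldl pstep (.arg R j ok) = .arg R j (l.getLast?.getD ok) ∧
    emitted pstep (pout eqs) (.arg R j ok) (l.map .bit) =
      if (eqs R).1 then l.map .bit else [] := by
  induction l generalizing ok with
  | nil => simp [emitted]
  | cons b l ih =>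
    obtain ⟨h1, h2⟩ := ih b
    refine ⟨by simp [pstep, h1, List.getLast?_cons], ?_⟩
    simp only [List.map_cons, emitted, pstep, h2, pout]
    cases (eqs R).1 <;> simp

theorem parse_bits_bound (ok : Bool) (l : List Bool) :
    (l.map (Letter.bit (Γ := Γ))).foldl pstep (.bound ok) = .bound (l.getLast?.getD ok) ∧
    emitted pstep (pout eqs) (.bound ok) (l.map .bit) = l.map .bit := by
  induction l generalizing ok with
  | nil => simp [emitted]
  | cons b l ih =>
    obtain ⟨h1, h2⟩ := ih b
    exact ⟨by simp [pstep, h1, List.getLast?_cons], by simp [emitted, pstep, h2, pout]⟩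

theorem getLast?_encodeNat (n : ℕ) : (encodeNat n).getLast?.getD true = true := by
  have h : IsCanonical (encodeNat n) := (isCanonical_iff _).2 ⟨n, rfl⟩
  unfold IsCanonical at h
  cases hb : (encodeNat n).getLast? with
  | none => rfl
  | some b => cases b <;> simp_all

theorem parse_args (R : Γ) (xs : List ℕ) (j : ℕ) (h : j + xs.length = R.1.arity) :
    (xs.flatMap fun x => codeNat Γ x ++ [Letter.sep]).foldl pstep (argState R j) = .start ∧
    emitted pstep (pout eqs) (argState R j) (xs.flatMap fun x => codeNat Γ x ++ [Letter.sep]) =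
      if (eqs R).1 then xs.flatMap fun x => codeName (encodeNat x) else [] := by
  induction xs generalizing j with
  | nil =>
    have : ¬ j < R.1.arity := by simp at h; omega
    simp [argState, this, emitted]
  | cons x xs ih =>
    simp only [List.length_cons] at h
    have hj : j < R.1.arity := by omega
    obtain ⟨h1, h2⟩ := ih (j + 1) (by omega)
    obtain ⟨h3, h4⟩ := parse_bits_arg eqs R ⟨j, hj⟩ true (encodeNat x)
    rw [getLast?_encodeNat] at h3
    have h5 : argState R j = .arg R ⟨j, hj⟩ true := dif_pos hj
    rw [List.flatMap_cons, List.foldl_append, emitted_append, List.foldl_append, emitted_append,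
      codeNat, h5, h3, h4]
    simp only [List.foldl_cons, List.foldl_nil, emitted, pstep, h1, h2, pout, true_and]
    cases (eqs R).1 <;> simp [codeName]

theorem parse_formula (φ : Formula Γ ℕ) :
    (φ.flatMap codeClause).foldl pstep .start = .start ∧
    emitted pstep (pout eqs) .start (φ.flatMap codeClause) = codeSys (sysOf eqs φ) := by
  induction φ with
  | nil => exact ⟨rfl, rfl⟩
  | cons C φ ih =>
    obtain ⟨h1, h2⟩ := ih
    obtain ⟨h3, h4⟩ := parse_args eqs C.rel (List.ofFn C.args) 0 (by simp)
    rw [List.flatMap_cons, List.foldl_append, emitted_append, codeClause, List.foldl_cons, pstep,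
      h3, h1, emitted, pstep, h2, h4]
    refine ⟨rfl, ?_⟩
    simp only [sysOf, codeSys, List.map_cons, List.flatMap_cons, codeEqn, pout]
    have hargs : List.ofFn (fun i => encodeNat (C.args i)) = (List.ofFn C.args).map encodeNat :=
      (List.map_ofFn (f := C.args) (g := encodeNat)).symm
    rw [hargs]
    cases (eqs C.rel).1 <;> simp [List.flatMap_map, -List.map_ofFn]

theorem parse_instance (φ : Formula Γ ℕ) (k : ℕ) :
    paccept ((codeInstance φ k).foldl pstep .start) = true ∧
    emitted pstep (pout eqs) .start (codeInstance φ k) =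
      codeSys (sysOf eqs φ) ++ Tok.mark true :: (encodeNat k).map Tok.bit := by
  obtain ⟨h1, h2⟩ := parse_formula eqs φ
  obtain ⟨h3, h4⟩ := parse_bits_bound eqs true (encodeNat k)
  have hk : codeInt Γ k = (encodeNat k).map .bit := by simp [codeInt, codeNat]
  rw [codeInstance, hk, List.foldl_append, emitted_append, h1, h2, List.foldl_cons, emitted]
  simp only [pstep, h3, h4, pout, getLast?_encodeNat, paccept]
  exact ⟨trivial, rfl⟩

/-! ### The decision problem -/

theorem map_bit_append_inj (l l' : List Bool) (b b' : Bool) (r r' : List Tok)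
    (h : l.map Tok.bit ++ .mark b :: r = l'.map Tok.bit ++ .mark b' :: r') :
    l = l' ∧ b = b' ∧ r = r' := by
  induction l generalizing l' with
  | nil => cases l' <;> simp_all
  | cons a l ih =>
    cases l' with
    | nil => simp at h
    | cons a' l' =>
      simp only [List.map_cons, List.cons_append, List.cons.injEq, Tok.bit.injEq] at h
      obtain ⟨rfl, h⟩ := h
      obtain ⟨h1, h2⟩ := ih l' h
      exact ⟨congrArg _ h1, h2⟩

/-- A symbol that does not belong to a name. -/
def Tok.IsOuter : Tok → Prop
  | .eqn _ => True
  | .mark b => b = true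
  | .bit _ => False

theorem codeName_ne_outer (y : List Bool) (a : Tok) (ha : a.IsOuter) (r r' : List Tok) :
    codeName y ++ r ≠ a :: r' := by
  rintro h
  cases y <;> simp [codeName] at h <;> obtain ⟨rfl, -⟩ := h <;> cases ha

theorem codeNames_append_inj (ys ys' : List (List Bool)) (a a' : Tok) (ha : a.IsOuter)
    (ha' : a'.IsOuter) (r r' : List Tok)
    (h : ys.flatMap codeName ++ a :: r = ys'.flatMap codeName ++ a' :: r') :
    ys = ys' ∧ a = a' ∧ r = r' := by
  induction ys generalizing ys' with
  | nil =>
    cases ys' with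
    | nil => simpa using h
    | cons y' ys' =>
      rw [List.flatMap_cons, List.append_assoc] at h
      exact absurd h.symm (codeName_ne_outer y' a ha _ _)
  | cons y ys ih =>
    cases ys' with
    | nil =>
      rw [List.flatMap_cons, List.append_assoc] at h
      exact absurd h (codeName_ne_outer y a' ha' _ _)
    | cons y' ys' =>
      simp only [List.flatMap_cons, codeName, List.append_assoc, List.singleton_append] at h
      obtain ⟨rfl, -, h⟩ := map_bit_append_inj _ _ _ _ _ _ h
      obtain ⟨h1, h2⟩ := ih ys' h
      exact ⟨congrArg _ h1, h2⟩

/-- After the names of an equation comes an `eqn` symbol or the set mark, neither of which can begin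
a name, so decoding is unambiguous. -/
theorem codeSys_append_inj (E E' : List (Bool × List (List Bool))) (r r' : List Tok)
    (h : codeSys E ++ .mark true :: r = codeSys E' ++ .mark true :: r') : E = E' ∧ r = r' := by
  have hcons (E : List (Bool × List (List Bool))) (r : List Tok) :
      ∃ a r₁, codeSys E ++ .mark true :: r = a :: r₁ ∧ a.IsOuter := by
    cases E with
    | nil => exact ⟨_, _, rfl, rfl⟩
    | cons e E => exact ⟨.eqn e.1, _, by rw [codeSys, List.flatMap_cons, codeEqn]; rfl, trivial⟩
  induction E generalizing E' with
  | nil =>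
    cases E' with
    | nil => simpa [codeSys] using h
    | cons e' E' => simp [codeSys, codeEqn] at h
  | cons e E ih =>
    cases E' with
    | nil => simp [codeSys, codeEqn] at h
    | cons e' E' =>
      simp only [codeSys, List.flatMap_cons, codeEqn, List.cons_append, List.append_assoc,
        List.cons.injEq, Tok.eqn.injEq] at h
      rw [← codeSys, ← codeSys] at h
      obtain ⟨a, r₁, h1, ha⟩ := hcons E r
      obtain ⟨a', r₁', h1', ha'⟩ := hcons E' r'
      obtain ⟨h2, h⟩ := h
      rw [h1, h1'] at h
      obtain ⟨h3, rfl, rfl⟩ := codeNames_append_inj _ _ _ _ ha ha' _ _ h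
      obtain ⟨rfl, h4⟩ := ih E' (h1.trans h1'.symm)
      exact ⟨by rw [Prod.ext h2 h3], h4⟩

variable {Γ : Set BoolRel} {eqs : Γ → Bool × Bool}

theorem exists_nat_bound_of_mem_mee {w : List (Letter Γ)} (hw : w ∈ MEE Γ) :
    ∃ (φ : Formula Γ ℕ) (k : ℕ), w = codeInstance φ k ∧
      ∃ ψ : Formula Γ ℕ, ψ.length ≤ k ∧ Equivalent ψ φ := by
  obtain ⟨φ, k, rfl, ψ, hψ, h⟩ := hw
  obtain ⟨k, rfl⟩ := Int.eq_ofNat_of_zero_le ((Int.natCast_nonneg _).trans hψ)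
  exact ⟨φ, k, rfl, ψ, by exact_mod_cast hψ, h⟩

/-- Membership allows any instance with the same code. The output of the parser depends on the word
only and determines system and bound, so all such instances have the same outcome. -/
theorem codeInstance_mem_iff (heqs : IsEquations eqs) (φ : Formula Γ ℕ) (k : ℕ) :
    codeInstance φ k ∈ MEE Γ ↔ outcome (minUnsat Γ) (sysOf eqs φ) ≤ k := by
  constructor
  · intro h
    obtain ⟨φ', k', hw, h⟩ := exists_nat_bound_of_mem_mee h
    have h1 := (parse_instance eqs φ k).2
    rw [hw, (parse_instance eqs φ' k').2] at h1
    obtain ⟨h2, h3⟩ := codeSys_append_inj _ _ _ _ h1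
    have h4 : k' = k := encodeNat_injective
      (List.map_injective_iff.2 (fun a b h => by injection h) h3)
    rw [← h2, ← h4]
    exact (outcome_le_iff heqs φ' k').2 h
  · intro h
    obtain ⟨ψ, hψ, h⟩ := (outcome_le_iff heqs φ k).1 h
    exact ⟨φ, k, rfl, ψ, by exact_mod_cast hψ, h⟩

/-- Words with a negative bound fail in the parser, rightly so: no formula has fewer than 0 clauses.
-/
theorem mee_inP (hΓ : Γ.Finite) (heqs : IsEquations eqs) : InP (MEE Γ) := by
  classical
  have hL := Letter.finite hΓ
  have hQ := PState.finite hΓ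
  have : ∀ i, Fintype (Alph (Letter Γ) (PState Γ) i) := fun i => by
    cases i
    case inp => exact Fintype.ofFinite (Letter Γ)
    case out => exact Fintype.ofFinite Bool
    case q => exact Fintype.ofFinite (PState Γ)
    all_goals exact Fintype.ofFinite Tok
  refine Cmd.inP_of_exec (K := Idx) (A := Alph (Letter Γ) (PState Γ)) (k₀ := .inp) (k₁ := .out) rfl
    (fun w => decide (w ∈ MEE Γ)) (fun w => decide_eq_true_iff)
    (decider pstep (pout eqs) .start paccept (minUnsat Γ))
    (Polynomial.C (300 + 30 * minUnsat Γ) * (Polynomial.X + 1) ^ 3) fun w => ?_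
  have hempty : (fun _ => [] : ∀ i, List (Alph (Letter Γ) (PState Γ) i)) =
      ({} : St (Letter Γ) (PState Γ)).get := by
    funext i; cases i <;> rfl
  rw [hempty, St.update_get, St.update_get]
  simp only [Polynomial.eval_mul, Polynomial.eval_C, Polynomial.eval_pow, Polynomial.eval_add,
    Polynomial.eval_X, Polynomial.eval_one]
  cases hw : paccept (w.foldl pstep .start) with
  | false =>
    have hmem : w ∉ MEE Γ := fun h => by
      obtain ⟨φ, k, rfl, -⟩ := exists_nat_bound_of_mem_mee h
      rw [(parse_instance eqs φ k).1] at hw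
      cases hw
    rw [decide_eq_false hmem]
    exact run_decider_reject pstep (pout eqs) .start paccept (minUnsat Γ) w hw
  | true =>
    obtain ⟨φ, k, rfl⟩ := exists_instance_of_accept w hw
    rw [decide_eq_decide.2 (codeInstance_mem_iff heqs φ k)]
    have := run_decider_accept pstep (pout eqs) .start paccept (minUnsat Γ) _ hw _ _
      (parse_instance eqs φ k).2
    rw [binVal_encodeNat] at this
    exact this

end BoolCSP

theorem mainTheorem5 (Γ : Set BoolCSP.BoolRel) (hΓ : BoolCSP.IsConstraintLanguage Γ)
    (hirr : BoolCSP.IrreducibleLanguage Γ) (haff : BoolCSP.AffineLanguage Γ) :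
    BoolCSP.InP (BoolCSP.MEE Γ) ∧
    (∀ (V : Type) [Fintype V] (φ : BoolCSP.Formula Γ V),
      BoolCSP.Satisfiable φ → BoolCSP.Irredundant φ →
        φ.length ≤ Fintype.card V ∧
        Nat.card {α : V → Bool // BoolCSP.Sat φ α} = 2 ^ (Fintype.card V - φ.length)) ∧
    (∀ (V : Type) (φ ψ : BoolCSP.Formula Γ V),
      BoolCSP.Satisfiable φ → BoolCSP.Irredundant φ → BoolCSP.Irredundant ψ →
        BoolCSP.Equivalent φ ψ → φ.length = ψ.length) := by
  obtain ⟨eqs, heqs⟩ := BoolCSP.exists_equations hΓ hirr haff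
  exact ⟨BoolCSP.mee_inP hΓ.1 heqs, fun V _ φ => BoolCSP.card_solutions heqs,
    fun V φ ψ => BoolCSP.length_eq_of_equivalent heqs⟩
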